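/- Let $k$ be an arbitrary field, $d\ge 1$ and $n\ge 0$ integers, $\ell_i=\sum_{j=0}^d\lambda_{ij}T_j$ ($1\le i\le n$) non-zero linear forms in $k[T_0,\dots,T_d]$, defining hyperplanes $H_1,\dots,H_n\subset\mathbb{P}^d$, and let $p_1,\dots,p_n$ be positive integers. Put \[R:=k[T_0,\dots,T_d,X_1,\dots,X_n]/(X_i^{p_i}-\ell_i\mid 1\le i\le n),\qquad \mathbb{L}:=\langle \vec{x}_1,\dots,\vec{x}_n,\vec{c}\rangle/\langle p_i\vec{x}_i-\vec{c}\mid 1\le i\le n\rangle\] ($\mathbb{L}$ an abelian group), where $R$ is $\mathbb{L}$-graded by $\deg T_j=\vec{c}$, $\deg X_i=\vec{x}_i$. For an abelian group $G$ and a commutative $G$-graded ring $A$ we use the following notions. $A$ is a $G$-domain (resp. a $G$-field) if $A\neq0$ and a product of two non-zero homogeneous elements is non-zero (resp. every non-zero homogeneous element is invertible). A homogeneous ideal $\mathfrak{p}$ is $G$-prime (resp. $G$-maximal) if $A/\mathfrak{p}$ is a $G$-domain (resp. $G$-field); for $\mathfrak{p}$ $G$-prime, $A_{(\mathfrak{p})}$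 is the $G$-graded localization of $A$ at the set of all homogeneous elements of $A\setminus\mathfrak{p}$. A non-zero homogeneous element $a$ is a $G$-prime element if $Aa$ is a $G$-prime ideal. A $G$-domain $A$ is $G$-factorial if every non-zero homogeneous non-unit of $A$ is a product of $G$-prime elements. $A$ is $G$-regular if the category of finitely generated $G$-graded $A$-modules (with degree-preserving $A$-linear maps) has finite global dimension, i.e. if there is an integer $N$ such that every object has a projective resolution of length at most $N$ in this category. $A$ has $G$-isolated singularities if $A_{(\mathfrak{p})}$ is $G$-regular for every $G$-prime ideal $\mathfrak{p}$ that is not $G$-maximal. Then: (1) $R$ is an $\mathbb{L}$-domain. (2) If the hyperplanes $H_1,\dots,H_n$ are pairwise distinct, then $R$ is $\mathbb{L}$-factorial. (3) If $H_1,\dots,H_n$ are in general position, i.e. any at most $d+1$ of the forms $\ell_1,\dots,\ell_n$ are linearly independent, then $R$ has $\mathbb{L}$-isolated singularities, and the localization $R_{T_j}$ of $R$ at the powers of $T_j$ is $\mathbb{L}$-regular for every $0\le j\le d$. -/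

import Mathlib

universe u

noncomputable section

section GradedRings

variable {G : Type*} [AddCommGroup G] {A : Type u} [CommRing A]
variable {σ : Type*} [SetLike σ A] [AddSubgroupClass σ A]

/-- A `G`-domain: the ring is non-zero, and a product of non-zero homogeneous elements is
non-zero. -/
def IsGDomain (𝒜 : G → σ) : Prop :=
  Nontrivial A ∧ ∀ a b : A, SetLike.IsHomogeneousElem 𝒜 a → SetLike.IsHomogeneousElem 𝒜 b →
    a ≠ 0 → b ≠ 0 → a * b ≠ 0

/-- A `G`-field: the ring is non-zero, and every non-zero homogeneous element is invertible. -/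
def IsGField (𝒜 : G → σ) : Prop :=
  Nontrivial A ∧ ∀ a : A, SetLike.IsHomogeneousElem 𝒜 a → a ≠ 0 → IsUnit a

/-- The family of subgroups of `A ⧸ I` given by the images of the homogeneous components
of `A`. It is a grading if `I` is homogeneous, see `quotGradedRing`. -/
def quotGrading (𝒜 : G → σ) (I : Ideal A) (g : G) : AddSubgroup (A ⧸ I) where
  carrier := {z | ∃ a ∈ 𝒜 g, Ideal.Quotient.mk I a = z}
  zero_mem' := ⟨0, zero_mem _, map_zero _⟩
  add_mem' := by
    rintro _ _ ⟨a, ha, rfl⟩ ⟨b, hb, rfl⟩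
    exact ⟨a + b, add_mem ha hb, map_add _ _ _⟩
  neg_mem' := by
    rintro _ ⟨a, ha, rfl⟩
    exact ⟨-a, neg_mem ha, map_neg _ _⟩

/-- The quotient of a graded ring by a homogeneous ideal is a graded ring. -/
abbrev quotGradedRing [DecidableEq G] (𝒜 : G → σ) [GradedRing 𝒜] (I : Ideal A)
    (hI : I.IsHomogeneous 𝒜) : GradedRing (quotGrading 𝒜 I) :=
  have hm : SetLike.GradedMonoid (quotGrading 𝒜 I) :=
    { one_mem := ⟨1, SetLike.GradedOne.one_mem, map_one _⟩
      mul_mem := by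
        rintro g h _ _ ⟨a, ha, rfl⟩ ⟨b, hb, rfl⟩
        exact ⟨a * b, SetLike.GradedMul.mul_mem ha hb, map_mul _ _ _⟩ }
  have hi : DirectSum.IsInternal (quotGrading 𝒜 I) := by
    classical
    constructor
    · rw [injective_iff_map_eq_zero]
      intro f hf
      have hch : ∀ g : G, ∃ a ∈ 𝒜 g, Ideal.Quotient.mk I a = (f g : A ⧸ I) := fun g => (f g).2
      choose a ha hfa using hch
      have hsum : ∑ g ∈ f.support, a g ∈ I := by
        rw [← Ideal.Quotient.eq_zero_iff_mem, map_sum, ← hf]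
        conv_rhs => rw [← DirectSum.sum_support_of f, map_sum]
        refine Finset.sum_congr rfl fun g _ => ?_
        rw [hfa, DirectSum.coeAddMonoidHom_of]
      ext g
      by_cases hg : g ∈ f.support
      · have h1 := hI g hsum
        rw [DirectSum.decompose_sum, DirectSum.sum_apply, AddSubmonoidClass.coe_finsetSum,
          Finset.sum_eq_single g, DirectSum.decompose_of_mem_same 𝒜 (ha g)] at h1
        · rw [← hfa, Ideal.Quotient.eq_zero_iff_mem.2 h1]
          simp
        · intro h _ hne
          exact DirectSum.decompose_of_mem_ne 𝒜 (ha h) hne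
        · exact fun h => absurd hg h
      · simpa using hg
    · intro z
      obtain ⟨a, rfl⟩ := Ideal.Quotient.mk_surjective z
      refine ⟨∑ g ∈ (DirectSum.decompose 𝒜 a).support, DirectSum.of (fun g => quotGrading 𝒜 I g) g
        ⟨Ideal.Quotient.mk I (DirectSum.decompose 𝒜 a g), _, (DirectSum.decompose 𝒜 a g).2, rfl⟩,
        ?_⟩
      rw [map_sum]
      simp only [DirectSum.coeAddMonoidHom_of]
      rw [← map_sum, DirectSum.sum_support_decompose]
  { hm, hi.chooseDecomposition with }

/-- A `G`-prime ideal: a homogeneous ideal `I` such that `A ⧸ I` is a `G`-domain. -/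
def IsGPrime [DecidableEq G] (𝒜 : G → σ) [GradedRing 𝒜] (I : Ideal A) : Prop :=
  I.IsHomogeneous 𝒜 ∧ IsGDomain (quotGrading 𝒜 I)

/-- A `G`-maximal ideal: a homogeneous ideal `I` such that `A ⧸ I` is a `G`-field. -/
def IsGMaximal [DecidableEq G] (𝒜 : G → σ) [GradedRing 𝒜] (I : Ideal A) : Prop :=
  I.IsHomogeneous 𝒜 ∧ IsGField (quotGrading 𝒜 I)

/-- A `G`-prime element: a non-zero homogeneous element generating a `G`-prime ideal. -/
def IsGPrimeElem [DecidableEq G] (𝒜 : G → σ) [GradedRing 𝒜] (a : A) : Prop :=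
  SetLike.IsHomogeneousElem 𝒜 a ∧ a ≠ 0 ∧ IsGPrime 𝒜 (Ideal.span {a})

/-- A `G`-factorial `G`-domain: a `G`-domain in which every non-zero homogeneous non-unit is a
product of `G`-prime elements. -/
def IsGFactorial [DecidableEq G] (𝒜 : G → σ) [GradedRing 𝒜] : Prop :=
  IsGDomain 𝒜 ∧ ∀ a : A, SetLike.IsHomogeneousElem 𝒜 a → a ≠ 0 → ¬ IsUnit a →
    ∃ s : Multiset A, (∀ b ∈ s, IsGPrimeElem 𝒜 b) ∧ s.prod = a

/-- The grading of the localization of `A` at a multiplicative set `M` of homogeneous elements: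
the elements of degree `g` are the fractions `a / s` with `s ∈ M` homogeneous of degree `i` and
`a` homogeneous of degree `g + i`. -/
def locGrading [DecidableEq G] (𝒜 : G → σ) [GradedRing 𝒜] (M : Submonoid A)
    (_hM : ∀ s ∈ M, SetLike.IsHomogeneousElem 𝒜 s) (g : G) : AddSubgroup (Localization M) where
  carrier := {z | ∃ (i : G) (a : A) (s : M), a ∈ 𝒜 (g + i) ∧ (s : A) ∈ 𝒜 i ∧
    z = Localization.mk a s}
  zero_mem' := ⟨0, 0, 1, zero_mem _, SetLike.GradedOne.one_mem, (Localization.mk_zero 1).symm⟩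
  add_mem' := by
    rintro _ _ ⟨i, a, s, ha, hs, rfl⟩ ⟨j, b, t, hb, ht, rfl⟩
    refine ⟨i + j, s * b + t * a, s * t, add_mem ?_ ?_, SetLike.GradedMul.mul_mem hs ht,
      Localization.add_mk _ _ _ _⟩
    · rw [add_left_comm]
      exact SetLike.GradedMul.mul_mem hs hb
    · rw [add_comm i j, add_left_comm]
      exact SetLike.GradedMul.mul_mem ht ha
  neg_mem' := by
    rintro _ ⟨i, a, s, ha, hs, rfl⟩
    exact ⟨i, -a, s, neg_mem ha, hs, Localization.neg_mk _ _⟩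

/-- Finitely many homogeneous fractions can be written with a common denominator. -/
theorem locGrading_common_denominator [DecidableEq G] (𝒜 : G → σ) [GradedRing 𝒜]
    (M : Submonoid A) (hM : ∀ s ∈ M, SetLike.IsHomogeneousElem 𝒜 s) (F : Finset G)
    (f : G → Localization M) (hf : ∀ g, f g ∈ locGrading 𝒜 M hM g) :
    ∃ (i : G) (s : M), (s : A) ∈ 𝒜 i ∧ ∀ g ∈ F, ∃ a ∈ 𝒜 (g + i), f g = Localization.mk a s := by
  induction F using Finset.induction_on with
  | empty => exact ⟨0, 1, SetLike.GradedOne.one_mem, by simp⟩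
  | insert g F _ ih =>
    obtain ⟨i, s, hs, h⟩ := ih
    obtain ⟨j, b, t, hb, ht, hg⟩ := hf g
    refine ⟨j + i, t * s, SetLike.GradedMul.mul_mem ht hs, fun g' hg' => ?_⟩
    rcases Finset.mem_insert.1 hg' with rfl | hg'
    · refine ⟨b * s, ?_, ?_⟩
      · rw [← add_assoc]
        exact SetLike.GradedMul.mul_mem hb hs
      · rw [hg, Localization.mk_eq_mk_iff, Localization.r_iff_exists]
        exact ⟨1, by push_cast; ring⟩
    · obtain ⟨a, ha, hga⟩ := h g' hg'
      refine ⟨t * a, ?_, ?_⟩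
      · rw [add_left_comm]
        exact SetLike.GradedMul.mul_mem ht ha
      · rw [hga, Localization.mk_eq_mk_iff, Localization.r_iff_exists]
        exact ⟨1, by push_cast; ring⟩

/-- The localization of a graded ring at homogeneous elements is a graded ring. -/
instance locGradedRing [DecidableEq G] (𝒜 : G → σ) [GradedRing 𝒜] (M : Submonoid A)
    (hM : ∀ s ∈ M, SetLike.IsHomogeneousElem 𝒜 s) : GradedRing (locGrading 𝒜 M hM) :=
  have hm : SetLike.GradedMonoid (locGrading 𝒜 M hM) :=
    { one_mem := ⟨0, 1, 1, by rw [add_zero]; exact SetLike.GradedOne.one_mem,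
        SetLike.GradedOne.one_mem, Localization.mk_one.symm⟩
      mul_mem := by
        rintro g h _ _ ⟨i, a, s, ha, hs, rfl⟩ ⟨j, b, t, hb, ht, rfl⟩
        refine ⟨i + j, a * b, s * t, ?_, SetLike.GradedMul.mul_mem hs ht,
          Localization.mk_mul _ _ _ _⟩
        rw [add_add_add_comm]
        exact SetLike.GradedMul.mul_mem ha hb }
  have hi : DirectSum.IsInternal (locGrading 𝒜 M hM) := by
    classical
    constructor
    · rw [injective_iff_map_eq_zero]
      intro f hf
      obtain ⟨i, s, hs, h⟩ := locGrading_common_denominator 𝒜 M hM f.support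
        (fun g => (f g : Localization M)) (fun g => (f g).2)
      have h' : ∀ g : G, ∃ a ∈ 𝒜 (g + i), (f g : Localization M) = Localization.mk a s := by
        intro g
        by_cases hg : g ∈ f.support
        · exact h g hg
        · refine ⟨0, zero_mem _, ?_⟩
          have : f g = 0 := by simpa using hg
          rw [this, Localization.mk_zero]
          rfl
      choose a ha hfa using h'
      have hsum : Localization.mk (∑ g ∈ f.support, a g) s = 0 := by
        rw [← hf]
        conv_rhs => rw [← DirectSum.sum_support_of f, map_sum]
        rw [Localization.mk_sum]
        refine Finset.sum_congr rfl fun g _ => ?_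
        rw [DirectSum.coeAddMonoidHom_of, hfa]
      rw [← Localization.mk_zero s, Localization.mk_eq_mk_iff, Localization.r_iff_exists] at hsum
      obtain ⟨t, ht⟩ := hsum
      obtain ⟨j, htj⟩ := hM t t.2
      obtain ⟨l, hl⟩ : ∃ l, (t : A) * s ∈ 𝒜 l := ⟨_, SetLike.GradedMul.mul_mem htj hs⟩
      have hz : ∑ g ∈ f.support, (t : A) * s * a g = 0 := by
        rw [← Finset.mul_sum, mul_assoc, ht]
        simp
      have hza : ∀ g ∈ f.support, (t : A) * s * a g = 0 := by
        intro g hg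
        have hmem : ∀ g, (t : A) * s * a g ∈ 𝒜 (l + (g + i)) :=
          fun g => SetLike.GradedMul.mul_mem hl (ha g)
        have h1 := congrArg (fun x => ((DirectSum.decompose 𝒜 x (l + (g + i)) : 𝒜 _) : A)) hz
        simp only [DirectSum.decompose_sum, DirectSum.sum_apply,
          AddSubmonoidClass.coe_finsetSum] at h1
        rw [Finset.sum_eq_single g, DirectSum.decompose_of_mem_same 𝒜 (hmem g)] at h1
        · simpa using h1
        · intro g' _ hne
          refine DirectSum.decompose_of_mem_ne 𝒜 (hmem g') fun he => hne ?_
          simpa using he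
        · exact fun h => absurd hg h
      ext g
      by_cases hg : g ∈ f.support
      · rw [hfa, DirectSum.zero_apply, ZeroMemClass.coe_zero, ← Localization.mk_zero s,
          Localization.mk_eq_mk_iff, Localization.r_iff_exists]
        refine ⟨t * s, ?_⟩
        have := hza g hg
        push_cast
        rw [mul_zero, mul_zero, mul_left_comm, this, mul_zero]
      · have : f g = 0 := by simpa using hg
        rw [this]
        rfl
    · intro z
      induction z using Localization.induction_on with
      | H x =>
        obtain ⟨a, s⟩ := x
        obtain ⟨i, hs⟩ := hM s s.2
        refine ⟨∑ g ∈ (DirectSum.decompose 𝒜 a).support,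
          DirectSum.of (fun g => locGrading 𝒜 M hM g) (g - i)
          ⟨Localization.mk (DirectSum.decompose 𝒜 a g : A) s, i, _, s,
            by rw [sub_add_cancel]; exact (DirectSum.decompose 𝒜 a g).2, hs, rfl⟩, ?_⟩
        rw [map_sum]
        simp only [DirectSum.coeAddMonoidHom_of]
        rw [← Localization.mk_sum, DirectSum.sum_support_decompose]
  { hm, hi.chooseDecomposition with }

/-- The multiplicative set of all homogeneous elements of `A` outside a `G`-prime ideal. -/
def IsGPrime.homogCompl [DecidableEq G] {𝒜 : G → σ} [GradedRing 𝒜] {P : Ideal A}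
    (hP : IsGPrime 𝒜 P) : Submonoid A where
  carrier := {s | SetLike.IsHomogeneousElem 𝒜 s ∧ s ∉ P}
  one_mem' := ⟨⟨0, SetLike.GradedOne.one_mem⟩, fun h =>
    (Ideal.Quotient.nontrivial_iff.1 hP.2.1) ((Ideal.eq_top_iff_one P).2 h)⟩
  mul_mem' := by
    rintro a b ⟨⟨i, ha⟩, haP⟩ ⟨⟨j, hb⟩, hbP⟩
    refine ⟨⟨i + j, SetLike.GradedMul.mul_mem ha hb⟩, fun h => ?_⟩
    refine hP.2.2 (Ideal.Quotient.mk P a) (Ideal.Quotient.mk P b) ⟨i, a, ha, rfl⟩ ⟨j, b, hb, rfl⟩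
      (fun h' => haP (Ideal.Quotient.eq_zero_iff_mem.1 h'))
      (fun h' => hbP (Ideal.Quotient.eq_zero_iff_mem.1 h')) ?_
    rw [← map_mul]
    exact Ideal.Quotient.eq_zero_iff_mem.2 h

/-- The grading of the homogeneous localization `A_(P)`, the localization of `A` at all
homogeneous elements outside the `G`-prime ideal `P`. -/
def IsGPrime.locGrading [DecidableEq G] {𝒜 : G → σ} [GradedRing 𝒜] {P : Ideal A}
    (hP : IsGPrime 𝒜 P) : G → AddSubgroup (Localization hP.homogCompl) :=
  _root_.locGrading 𝒜 hP.homogCompl fun _ hs => hs.1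

instance IsGPrime.gradedRing [DecidableEq G] {𝒜 : G → σ} [GradedRing 𝒜] {P : Ideal A}
    (hP : IsGPrime 𝒜 P) : GradedRing hP.locGrading :=
  locGradedRing 𝒜 hP.homogCompl fun _ hs => hs.1

/-- The grading of the localization `A_a` of `A` at the powers of a homogeneous element `a`. -/
def awayGrading [DecidableEq G] (𝒜 : G → σ) [GradedRing 𝒜] (a : A)
    (ha : SetLike.IsHomogeneousElem 𝒜 a) : G → AddSubgroup (Localization (Submonoid.powers a)) :=
  locGrading 𝒜 (Submonoid.powers a) fun s hs => by
    have h : Submonoid.powers a ≤ SetLike.homogeneousSubmonoid 𝒜 :=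
      (Submonoid.powers_le).2 ha
    exact h hs

instance awayGradedRing [DecidableEq G] (𝒜 : G → σ) [GradedRing 𝒜] (a : A)
    (ha : SetLike.IsHomogeneousElem 𝒜 a) : GradedRing (awayGrading 𝒜 a ha) :=
  locGradedRing 𝒜 (Submonoid.powers a) _

/-- The objects of the category of finitely generated `G`-graded `A`-modules. -/
structure GrMod [DecidableEq G] (𝒜 : G → σ) [GradedRing 𝒜] where
  carrier : Type u
  [addCommGroup : AddCommGroup carrier]
  [module : Module A carrier]
  /-- The homogeneous components. -/
  comp : G → AddSubgroup carrier
  isInternal : DirectSum.IsInternal comp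
  smul_mem : ∀ (g h : G) (a : A) (m : carrier), a ∈ 𝒜 g → m ∈ comp h → a • m ∈ comp (g + h)
  finite : Module.Finite A carrier

namespace GrMod

variable [DecidableEq G] {𝒜 : G → σ} [GradedRing 𝒜]

attribute [instance] GrMod.addCommGroup GrMod.module

/-- The morphisms of graded modules: `A`-linear maps that preserve degrees. -/
structure Hom (M N : GrMod 𝒜) where
  toLin : M.carrier →ₗ[A] N.carrier
  map_mem : ∀ (g : G) (m : M.carrier), m ∈ M.comp g → toLin m ∈ N.comp g

/-- The projective objects of the category of finitely generated graded modules. -/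
def IsProjective (P : GrMod 𝒜) : Prop :=
  ∀ (M N : GrMod 𝒜) (f : Hom M N) (g : Hom P N), Function.Surjective f.toLin →
    ∃ h : Hom P M, f.toLin ∘ₗ h.toLin = g.toLin

/-- `ProjDimLE n M`: the graded module `M` has a resolution
`0 → P_n → ⋯ → P_1 → P_0 → M → 0` by projective objects, split into short exact sequences. -/
def ProjDimLE : ℕ → GrMod 𝒜 → Prop
  | 0, M => M.IsProjective
  | n + 1, M => ∃ (P K : GrMod 𝒜) (i : Hom K P) (q : Hom P M), P.IsProjective ∧
      Function.Injective i.toLin ∧ Function.Exact i.toLin q.toLin ∧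
      Function.Surjective q.toLin ∧ ProjDimLE n K

end GrMod

/-- `A` is `G`-regular: the category of finitely generated `G`-graded `A`-modules has finite
global dimension. -/
def IsGRegular [DecidableEq G] (𝒜 : G → σ) [GradedRing 𝒜] : Prop :=
  ∃ n : ℕ, ∀ M : GrMod 𝒜, GrMod.ProjDimLE n M

/-- `A` has `G`-isolated singularities: `A_(P)` is `G`-regular for every `G`-prime ideal `P` that
is not `G`-maximal. -/
def HasGIsolatedSingularities [DecidableEq G] (𝒜 : G → σ) [GradedRing 𝒜] : Prop :=
  ∀ (P : Ideal A) (hP : IsGPrime 𝒜 P), ¬ IsGMaximal 𝒜 P → IsGRegular hP.locGrading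

end GradedRings

namespace GeigleLenzing

open MvPolynomial

/-- The abelian group `𝕃` generated by `x_1, …, x_n, c` modulo the relations `p_i x_i = c`. -/
def LGroup {n : ℕ} (p : Fin n → ℕ) : Type :=
  ((Fin n → ℤ) × ℤ) ⧸
    AddSubgroup.closure (Set.range fun i : Fin n =>
      (p i • ((Pi.single i 1, 0) : (Fin n → ℤ) × ℤ) - (0, 1)))

instance {n : ℕ} (p : Fin n → ℕ) : AddCommGroup (LGroup p) :=
  inferInstanceAs (AddCommGroup (((Fin n → ℤ) × ℤ) ⧸ AddSubgroup.closure _))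

instance {n : ℕ} (p : Fin n → ℕ) : DecidableEq (LGroup p) := Classical.decEq _

/-- The generator `x_i` of `𝕃`. -/
def LGroup.x {n : ℕ} (p : Fin n → ℕ) (i : Fin n) : LGroup p :=
  QuotientAddGroup.mk ((Pi.single i 1, 0) : (Fin n → ℤ) × ℤ)

/-- The generator `c` of `𝕃`. -/
def LGroup.c {n : ℕ} (p : Fin n → ℕ) : LGroup p :=
  QuotientAddGroup.mk ((0, 1) : (Fin n → ℤ) × ℤ)

theorem LGroup.smul_x {n : ℕ} (p : Fin n → ℕ) (i : Fin n) : p i • LGroup.x p i = LGroup.c p := by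
  rw [← sub_eq_zero]
  exact (QuotientAddGroup.eq_zero_iff _).2 (AddSubgroup.subset_closure ⟨i, rfl⟩)

variable (k : Type u) [Field k] (d n : ℕ)

/-- The polynomial ring `S = k[T_0, …, T_d, X_1, …, X_n]`. The variable `T_j` is indexed by
`Sum.inl j` and the variable `X_i` by `Sum.inr i`. -/
abbrev PolyS : Type u := MvPolynomial (Fin (d + 1) ⊕ Fin n) k

variable {k d n}

/-- The degrees of the variables: `deg T_j = c` and `deg X_i = x_i`. -/
def varDeg (d : ℕ) {n : ℕ} (p : Fin n → ℕ) : Fin (d + 1) ⊕ Fin n → LGroup p :=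
  Sum.elim (fun _ => LGroup.c p) (fun i => LGroup.x p i)

/-- The linear form `ℓ_i = ∑_j lam_{ij} T_j`, as an element of `S`. -/
def linForm (lam : Fin n → Fin (d + 1) → k) (i : Fin n) : PolyS k d n :=
  ∑ j : Fin (d + 1), C (lam i j) * X (Sum.inl j)

/-- The ideal of `S` generated by the elements `h_i = X_i ^ p_i - ℓ_i`. -/
def relIdeal (lam : Fin n → Fin (d + 1) → k) (p : Fin n → ℕ) : Ideal (PolyS k d n) :=
  Ideal.span (Set.range fun i : Fin n => X (Sum.inr i) ^ p i - linForm lam i)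

/-- The `k`-algebra `R = S / (h_1, …, h_n)`. -/
abbrev GLRing (lam : Fin n → Fin (d + 1) → k) (p : Fin n → ℕ) : Type u :=
  PolyS k d n ⧸ relIdeal lam p

/-- The `𝕃`-grading of `S`. -/
abbrev gradingS (k : Type u) [Field k] (d : ℕ) {n : ℕ} (p : Fin n → ℕ) :
    LGroup p → Submodule k (PolyS k d n) :=
  weightedHomogeneousSubmodule k (varDeg d p)

instance gradedS (k : Type u) [Field k] (d : ℕ) {n : ℕ} (p : Fin n → ℕ) :
    GradedAlgebra (gradingS k d p) :=
  weightedGradedAlgebra k (varDeg d p)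

theorem relIdeal_isHomogeneous (lam : Fin n → Fin (d + 1) → k) (p : Fin n → ℕ) :
    (relIdeal lam p).IsHomogeneous (gradingS k d p) := by
  refine Ideal.homogeneous_span _ _ ?_
  rintro _ ⟨i, rfl⟩
  refine ⟨LGroup.c p, sub_mem ?_ (Submodule.sum_mem _ fun j _ => ?_)⟩
  · have h := (isWeightedHomogeneous_X k (varDeg d p) (Sum.inr i)).pow (p i)
    have e : p i • varDeg d p (Sum.inr i) = LGroup.c p := LGroup.smul_x p i
    rwa [e] at h
  · have h := (isWeightedHomogeneous_C (varDeg d p) (lam i j)).mul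
      (isWeightedHomogeneous_X k (varDeg d p) (Sum.inl j))
    rw [zero_add] at h
    exact h

/-- The `𝕃`-grading of `R` induced by the grading of `S`. -/
def gradingR (lam : Fin n → Fin (d + 1) → k) (p : Fin n → ℕ) :
    LGroup p → AddSubgroup (GLRing lam p) :=
  quotGrading (gradingS k d p) (relIdeal lam p)

instance gradedR (lam : Fin n → Fin (d + 1) → k) (p : Fin n → ℕ) :
    GradedRing (gradingR lam p) :=
  quotGradedRing (gradingS k d p) (relIdeal lam p) (relIdeal_isHomogeneous lam p)

/-- The image of the variable `T_j` in `R`. -/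
def varT (lam : Fin n → Fin (d + 1) → k) (p : Fin n → ℕ) (j : Fin (d + 1)) : GLRing lam p :=
  Ideal.Quotient.mk (relIdeal lam p) (X (Sum.inl j))

theorem varT_isHomogeneous (lam : Fin n → Fin (d + 1) → k) (p : Fin n → ℕ) (j : Fin (d + 1)) :
    SetLike.IsHomogeneousElem (gradingR lam p) (varT lam p j) :=
  ⟨LGroup.c p, X (Sum.inl j), isWeightedHomogeneous_X k (varDeg d p) (Sum.inl j), rfl⟩

/-- The linear forms define pairwise distinct hyperplanes, i.e. no two of them are proportional. -/
def DistinctHyperplanes (lam : Fin n → Fin (d + 1) → k) : Prop :=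
  ∀ i j : Fin n, i ≠ j → LinearIndependent k ![lam i, lam j]

/-- The hyperplanes are in general position: any at most `d + 1` of the linear forms are linearly
independent. -/
def GeneralPosition (lam : Fin n → Fin (d + 1) → k) : Prop :=
  ∀ s : Finset (Fin n), s.card ≤ d + 1 → LinearIndependent k (fun i : s => lam i)

end GeigleLenzing

end

/-! Division with remainder of the exponents of the `X_i` writes every homogeneous element of R as a
monomial `X^κ` with `κ_i < p_i`, determined by the degree, times a homogeneous polynomial in the
`T_j` (`exists_eq_monoX_mul_incl`). To calculate with these normal forms, choose `p_i`-th roots of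
the `ℓ_i` in an algebraic closure Ω of `k(T_0, …, T_d)` and map R to the group algebra `Ω[∏ ℤ/p_i]`,
sending `X_i` to its root times the group element `e_i`. A non-zero homogeneous element goes to a
non-zero multiple of one group element, so (1) follows because Ω is a field.

For (2), the group algebra reduces divisibility in R to divisibility in `k[T]`. Each `X_i` is a
graded prime because `ℓ_i` is prime and divides no other `ℓ_j`; a homogeneous prime of `k[T]`
dividing no `ℓ_i` stays prime in R. The normal form and unique factorization in `k[T]` then factor
every homogeneous element.

For (3), graded regularity follows from a uniform bound on ungraded projective dimensions, which may
be checked at the maximal ideals m of a localization in which some `T_j` is invertible. Let I be the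
set of i with `X_i` in m. General position makes the `ℓ_i`, `i ∈ I`, linearly independent; completed
to a basis of linear forms, they yield a polynomial subring B of R in `d + 1` variables, among them
the `X_i` with `i ∈ I`. Over B, R is free on the bounded monomials in the remaining `X_i`, which are
units at m. A graded module M therefore agrees near m with the flat base change of its residue-zero
part `M_0` (`modPdLE_localizedModule_of_decomposition`), and the syzygy theorem for B gives the
bound `d + 1`. For isolated singularities, it remains to see that a graded prime containing all
`T_j` is graded maximal. -/

noncomputable section

/-! ### Projective dimension: flat base change and polynomial rings. -/

section ProjectiveDimension

open CategoryTheory TensorProduct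

/-- The module `M` has projective dimension at most `n`. -/
abbrev ModPdLE (A : Type u) [CommRing A] (M : Type u) [AddCommGroup M] [Module A M] (n : ℕ) :
    Prop :=
  HasProjectiveDimensionLE (ModuleCat.of A M) n

/-- Every module over the ring `A` has projective dimension at most `n`. -/
def GlobalDimLE (A : Type u) [CommRing A] (n : ℕ) : Prop :=
  ∀ (M : Type u) [AddCommGroup M] [Module A M], ModPdLE A M n

variable {A B : Type u} [CommRing A] [CommRing B]
variable {M N P : Type u} [AddCommGroup M] [AddCommGroup N] [AddCommGroup P]

theorem modPdLE_zero_iff [Module A M] : ModPdLE A M 0 ↔ Module.Projective A M := by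
  rw [ModPdLE, ← projective_iff_hasProjectiveDimensionLE_zero, ← IsProjective.iff_projective]

theorem ModPdLE.of_linearEquiv [Module A M] [Module A N] {n : ℕ} (h : ModPdLE A M n)
    (e : M ≃ₗ[A] N) : ModPdLE A N n :=
  have := h
  ModuleCat.hasProjectiveDimensionLE_of_linearEquiv (M := ModuleCat.of A M)
    (N := ModuleCat.of A N) e n

theorem ModPdLE.mono [Module A M] {m n : ℕ} (h : ModPdLE A M m) (hmn : m ≤ n) : ModPdLE A M n :=
  have := h
  hasProjectiveDimensionLT_of_ge (ModuleCat.of A M) (m + 1) (n + 1) (by omega)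

/-- An injective and a surjective linear map forming an exact pair give a short exact sequence. -/
theorem shortExact_of_exact [Module A M] [Module A N] [Module A P] (f : M →ₗ[A] N) (g : N →ₗ[A] P)
    (hf : Function.Injective f) (hfg : Function.Exact f g) (hg : Function.Surjective g) :
    (ModuleCat.shortComplexOfCompEqZero f g hfg.linearMap_comp_eq_zero).ShortExact where
  exact := (ShortComplex.ShortExact.moduleCat_exact_iff_function_exact _).mpr hfg
  mono_f := (ModuleCat.mono_iff_injective _).mpr hf
  epi_g := (ModuleCat.epi_iff_surjective _).mpr hg

theorem ModPdLE.of_exact [Module A M] [Module A N] [Module A P] {n : ℕ} (f : M →ₗ[A] N)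
    (g : N →ₗ[A] P) (hf : Function.Injective f) (hfg : Function.Exact f g)
    (hg : Function.Surjective g) (hM : ModPdLE A M n) (hN : ModPdLE A N (n + 1)) :
    ModPdLE A P (n + 1) :=
  (shortExact_of_exact f g hf hfg hg).hasProjectiveDimensionLT_X₃ (n + 1) hM hN

theorem ModPdLE.of_exact_projective [Module A M] [Module A N] [Module A P] {n : ℕ} (f : M →ₗ[A] N)
    (g : N →ₗ[A] P) (hf : Function.Injective f) (hfg : Function.Exact f g)
    (hg : Function.Surjective g) (hN : Module.Projective A N) (hP : ModPdLE A P (n + 1)) :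
    ModPdLE A M n :=
  (shortExact_of_exact f g hf hfg hg).hasProjectiveDimensionLT_X₁ (n + 1)
    ((modPdLE_zero_iff.2 hN).mono (by omega)) hP

/-- Projective dimension does not grow under flat base change. -/
theorem ModPdLE.baseChange [Algebra B A] [Module.Flat B A] [Module B M] {n : ℕ}
    (h : ModPdLE B M n) : ModPdLE A (A ⊗[B] M) n := by
  induction n generalizing M with
  | zero =>
    rw [modPdLE_zero_iff] at h ⊢
    infer_instance
  | succ n ih =>
    -- The free cover on all elements of M. Its kernel drops one in projective dimension, and
    -- flatness keeps the sequence exact.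
    let g : (M →₀ B) →ₗ[B] M := Finsupp.linearCombination B id
    have hg : Function.Surjective g := Finsupp.linearCombination_id_surjective B M
    have hex : Function.Exact (LinearMap.ker g).subtype g := LinearMap.exact_subtype_ker_map g
    have hK := ih (ModPdLE.of_exact_projective (M := LinearMap.ker g) (LinearMap.ker g).subtype g
      (LinearMap.ker g).injective_subtype hex hg inferInstance h)
    refine ModPdLE.of_exact ((LinearMap.ker g).subtype.baseChange A) (g.baseChange A) ?_ ?_ ?_ hK ?_
    · exact Module.Flat.lTensor_preserves_injective_linearMap (LinearMap.ker g).subtype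
        (LinearMap.ker g).injective_subtype
    · exact lTensor_exact (R := B) (M := LinearMap.ker g) (N := M →₀ B) (P := M) A hex hg
    · exact LinearMap.lTensor_surjective A hg
    · exact (modPdLE_zero_iff.2 inferInstance).mono (Nat.zero_le _)

theorem GlobalDimLE.of_ringEquiv {n : ℕ} (h : GlobalDimLE B n) (e : B ≃+* A) : GlobalDimLE A n := by
  intro M _ _
  let _ : Module B M := Module.compHom M e.toRingHom
  have := h M
  let e' : letI := RingHomInvPair.of_ringEquiv e; letI := (RingHomInvPair.of_ringEquiv e).symm
      (ModuleCat.of B M) ≃ₛₗ[RingHomClass.toRingHom e] (ModuleCat.of A M) :=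
    letI := RingHomInvPair.of_ringEquiv e; letI := (RingHomInvPair.of_ringEquiv e).symm
    { AddEquiv.refl M with map_smul' := fun _ _ => rfl }
  exact ModuleCat.hasProjectiveDimensionLE_of_semiLinearEquiv e e' n

theorem globalDimLE_field (k : Type u) [Field k] : GlobalDimLE k 0 := fun _ _ _ =>
  modPdLE_zero_iff.2 inferInstance

open Polynomial in
/-- The global dimension of `A[X]` is at most one more than that of `A`. -/
theorem GlobalDimLE.polynomial {n : ℕ} (h : GlobalDimLE A n) : GlobalDimLE A[X] (n + 1) := by
  intro M _ _
  let _ : Module A M := Module.compHom M (C : A →+* A[X])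
  have : IsScalarTower A A[X] M := ⟨fun a f m => by
    rw [Polynomial.smul_eq_C_mul, mul_smul]; rfl⟩
  let xM : M →ₗ[A] M := (LinearMap.lsmul A[X] M X).restrictScalars A
  let p : A[X] ⊗[A] M →ₗ[A[X]] M := (TensorProduct.AlgebraTensorModule.lift
    ((LinearMap.lsmul A[X] M).flip.restrictScalars A).flip)
  have hp : ∀ (f : A[X]) (m : M), p (f ⊗ₜ m) = f • m := fun f m => rfl
  -- The difference of the two actions of X, giving the sequence `0 → A[X] ⊗ M → A[X] ⊗ M → M → 0`
  -- with maps q and p.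
  let q : A[X] ⊗[A] M →ₗ[A[X]] A[X] ⊗[A] M :=
    LinearMap.lsmul A[X] _ X - xM.baseChange A[X]
  have hq : ∀ (f : A[X]) (m : M), q (f ⊗ₜ m) = (X * f) ⊗ₜ m - f ⊗ₜ ((X : A[X]) • m) := fun f m => rfl
  -- The divided difference, an A-linear contraction: `r q = id` and `q r + 1 ⊗ p = id` by
  -- telescoping, which yields exactness.
  let r : A[X] ⊗[A] M →ₗ[A] A[X] ⊗[A] M := TensorProduct.lift (Polynomial.lsum fun i =>
    LinearMap.toSpanSingleton A _ (∑ j ∈ Finset.range i,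
      (TensorProduct.mk A A[X] M (X ^ (i - 1 - j))) ∘ₗ (xM ^ j)))
  have hr : ∀ (i : ℕ) (m : M), r ((X ^ i) ⊗ₜ m) =
      ∑ j ∈ Finset.range i, (X ^ (i - 1 - j) : A[X]) ⊗ₜ[A] ((X : A[X]) ^ j • m) := by
    intro i m
    have hX : ∀ j, (xM ^ j) m = (X : A[X]) ^ j • m := fun j => by
      induction j with
      | zero => simp
      | succ j ih => rw [pow_succ', Module.End.mul_apply, ih, pow_succ', mul_smul]; rfl
    simp only [r, lift.tmul, ← monomial_one_right_eq_X_pow, lsum_apply]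
    rw [sum_monomial_index _ _ (by simp)]
    simp [hX, monomial_one_right_eq_X_pow]
  have hspan : ∀ (Q : A[X] ⊗[A] M → Prop), (∀ x y, Q x → Q y → Q (x + y)) → Q 0 →
      (∀ i m, Q ((X ^ i) ⊗ₜ m)) → ∀ x, Q x := by
    intro Q hadd h0 hX x
    induction x using TensorProduct.induction_on with
    | zero => exact h0
    | add x y hx hy => exact hadd x y hx hy
    | tmul f m =>
      induction f using Polynomial.induction_on' with
      | add f g hf hg => rw [add_tmul]; exact hadd _ _ hf hg
      | monomial i a =>
        rw [← mul_one a, ← smul_eq_mul, ← Polynomial.smul_monomial, smul_tmul,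
          Polynomial.monomial_one_right_eq_X_pow]
        exact hX i _
  have hrq : ∀ x, r (q x) = x := by
    refine hspan _ (fun x y hx hy => by rw [map_add, map_add, hx, hy]) (by simp) fun i m => ?_
    rw [hq, map_sub, ← pow_succ', hr, hr, Finset.sum_range_succ', add_sub_right_comm, ← Finset.sum_sub_distrib,
      Finset.sum_eq_zero]
    · simp
    · intro j _
      rw [← mul_smul, ← pow_succ, show i + 1 - 1 - (j + 1) = i - 1 - j by omega, sub_self]
  have hqr : ∀ x, q (r x) + 1 ⊗ₜ p x = x := by
    refine hspan _ (fun x y hx hy => ?_) (by simp) fun i m => ?_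
    · conv_rhs => rw [← hx, ← hy]
      simp only [map_add, tmul_add]
      abel
    · have hf : ∀ j ∈ Finset.range i, q ((X ^ (i - 1 - j) : A[X]) ⊗ₜ[A] ((X : A[X]) ^ j • m)) =
          (X ^ (i - j) : A[X]) ⊗ₜ[A] ((X : A[X]) ^ j • m) -
            (X ^ (i - (j + 1)) : A[X]) ⊗ₜ[A] ((X : A[X]) ^ (j + 1) • m) := by
        intro j hj
        have := Finset.mem_range.1 hj
        rw [hq, ← mul_smul, ← pow_succ', ← pow_succ', show i - 1 - j + 1 = i - j by omega,
          show i - 1 - j = i - (j + 1) by omega]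
      rw [hr, hp, map_sum, Finset.sum_congr rfl hf, Finset.sum_range_sub'
        (fun j => (X ^ (i - j) : A[X]) ⊗ₜ[A] ((X : A[X]) ^ j • m))]
      simp
  refine ModPdLE.of_exact q p (Function.LeftInverse.injective hrq) (fun x => ⟨fun hx => ?_, ?_⟩)
    (fun m => ⟨1 ⊗ₜ m, by rw [hp, one_smul]⟩) ?_ ?_
  · have := hqr x
    rw [hx, tmul_zero, add_zero] at this
    exact ⟨_, this⟩
  · rintro ⟨y, rfl⟩
    refine hspan (fun y => p (q y) = 0) (fun x y hx hy => ?_) (by simp) (fun i m => ?_) y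
    · rw [map_add, map_add, hx, hy, add_zero]
    · rw [hq, map_sub, hp, hp, ← mul_smul, ← pow_succ, ← pow_succ', sub_self]
  · exact (h M).baseChange
  · exact ((h M).baseChange).mono (Nat.le_succ n)

/-- Hilbert's syzygy theorem; it is applied to the coordinate subrings of R. -/
theorem globalDimLE_mvPolynomial_fin (k : Type u) [Field k] (m : ℕ) :
    GlobalDimLE (MvPolynomial (Fin m) k) m := by
  induction m with
  | zero => exact (globalDimLE_field k).of_ringEquiv (MvPolynomial.isEmptyRingEquiv k (Fin 0)).symm
  | succ m ih => exact ih.polynomial.of_ringEquiv (MvPolynomial.finSuccEquiv k m).symm.toRingEquiv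

end ProjectiveDimension

end

noncomputable section

/-! ### Graded resolutions from ungraded projective dimension. -/

section GradedModules

variable {G : Type*}

/-- A family of subgroups is an internal direct sum decomposition if it admits a family of
projections. -/
theorem isInternal_of_projections [DecidableEq G] {M : Type*} [AddCommGroup M]
    (comp : G → AddSubgroup M) (π : G → M →+ M) (hmem : ∀ g m, π g m ∈ comp g)
    (hself : ∀ g, ∀ m ∈ comp g, π g m = m) (hne : ∀ g h, h ≠ g → ∀ m ∈ comp h, π g m = 0)
    (hsum : ∀ m, ∃ s : Finset G, ∑ g ∈ s, π g m = m) : DirectSum.IsInternal comp := by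
  classical
  constructor
  · rw [injective_iff_map_eq_zero]
    intro f hf
    ext h
    have h1 : ∑ g ∈ f.support, (f g : M) = 0 := by
      rw [← hf]
      conv_rhs => rw [← DirectSum.sum_support_of f, map_sum]
      simp only [DirectSum.coeAddMonoidHom_of]
    have h2 := congrArg (π h) h1
    rw [map_sum, map_zero, Finset.sum_eq_single h (fun g _ hg => hne h g hg _ (f g).2),
      hself h _ (f h).2] at h2
    · simpa using h2
    · intro hh
      rw [DFinsupp.notMem_support_iff.1 hh]
      simp
  · intro m
    obtain ⟨s, hs⟩ := hsum m
    refine ⟨∑ g ∈ s, DirectSum.of (fun g => comp g) g ⟨π g m, hmem g m⟩, ?_⟩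
    rw [map_sum]
    simpa only [DirectSum.coeAddMonoidHom_of] using hs

variable [AddCommGroup G] [DecidableEq G] {A : Type u} [CommRing A]
variable {σ : Type*} [SetLike σ A] [AddSubgroupClass σ A] {𝒜 : G → σ} [GradedRing 𝒜]

namespace GrMod

/-- The projection of a graded module onto a homogeneous component. -/
def proj (M : GrMod 𝒜) (g : G) : M.carrier →+ M.carrier :=
  letI := M.isInternal.chooseDecomposition
  (M.comp g).subtype.comp ((DFinsupp.evalAddMonoidHom g).comp
    (DirectSum.decomposeAddEquiv M.comp).toAddMonoidHom)

theorem proj_mem (M : GrMod 𝒜) (g : G) (m : M.carrier) : M.proj g m ∈ M.comp g :=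
  SetLike.coe_mem _

theorem proj_of_mem (M : GrMod 𝒜) {g : G} {m : M.carrier} (hm : m ∈ M.comp g) :
    M.proj g m = m :=
  letI := M.isInternal.chooseDecomposition
  DirectSum.decompose_of_mem_same M.comp hm

theorem proj_of_mem_ne (M : GrMod 𝒜) {g h : G} {m : M.carrier} (hm : m ∈ M.comp h) (hne : h ≠ g) :
    M.proj g m = 0 :=
  letI := M.isInternal.chooseDecomposition
  DirectSum.decompose_of_mem_ne M.comp hm hne

theorem exists_sum_proj (M : GrMod 𝒜) (m : M.carrier) :
    ∃ s : Finset G, ∑ g ∈ s, M.proj g m = m := by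
  classical
  let := M.isInternal.chooseDecomposition
  exact ⟨_, DirectSum.sum_support_decompose M.comp m⟩

theorem homogeneous_induction (M : GrMod 𝒜) {Q : M.carrier → Prop} (m : M.carrier) (zero : Q 0)
    (add : ∀ x y, Q x → Q y → Q (x + y)) (hom : ∀ g, ∀ x ∈ M.comp g, Q x) : Q m := by
  obtain ⟨s, hs⟩ := M.exists_sum_proj m
  rw [← hs]
  exact Finset.sum_induction _ Q add zero fun g _ => hom g _ (M.proj_mem g m)

theorem proj_smul (M : GrMod 𝒜) {h : G} (g : G) {a : A} (ha : a ∈ 𝒜 h) (m : M.carrier) :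
    M.proj (h + g) (a • m) = a • M.proj g m := by
  induction m using M.homogeneous_induction with
  | zero => simp
  | add x y hx hy => simp only [smul_add, map_add, hx, hy]
  | hom i x hx =>
    by_cases hi : i = g
    · subst hi
      rw [M.proj_of_mem hx, M.proj_of_mem (M.smul_mem _ _ _ _ ha hx)]
    · rw [M.proj_of_mem_ne hx hi, smul_zero,
        M.proj_of_mem_ne (M.smul_mem _ _ _ _ ha hx) fun h => hi (add_left_cancel h)]

theorem Hom.map_proj {M N : GrMod 𝒜} (f : Hom M N) (g : G) (m : M.carrier) :
    f.toLin (M.proj g m) = N.proj g (f.toLin m) := by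
  induction m using M.homogeneous_induction with
  | zero => simp
  | add x y hx hy => simp only [map_add, hx, hy]
  | hom i x hx =>
    by_cases hi : i = g
    · subst hi
      rw [M.proj_of_mem hx, N.proj_of_mem (f.map_mem _ _ hx)]
    · rw [M.proj_of_mem_ne hx hi, map_zero, N.proj_of_mem_ne (f.map_mem _ _ hx) hi]

/-- The degree zero part of a linear map between graded modules. -/
def degreeZeroPart {M N : GrMod 𝒜} (f : M.carrier →ₗ[A] N.carrier) : M.carrier →+ N.carrier :=
  letI := M.isInternal.chooseDecomposition
  (DirectSum.toAddMonoid fun g => (N.proj g).comp (f.toAddMonoidHom.comp (M.comp g).subtype)).comp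
    (DirectSum.decomposeAddEquiv M.comp).toAddMonoidHom

theorem degreeZeroPart_apply {M N : GrMod 𝒜} (f : M.carrier →ₗ[A] N.carrier) {g : G}
    {m : M.carrier} (hm : m ∈ M.comp g) : degreeZeroPart f m = N.proj g (f m) := by
  let := M.isInternal.chooseDecomposition
  have h : DirectSum.decompose M.comp m = DirectSum.of (fun i => M.comp i) g ⟨m, hm⟩ :=
    DirectSum.decompose_of_mem M.comp hm
  simp [degreeZeroPart, h]

theorem degreeZeroPart_smul {M N : GrMod 𝒜} (f : M.carrier →ₗ[A] N.carrier) (a : A)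
    (m : M.carrier) : degreeZeroPart f (a • m) = a • degreeZeroPart f m := by
  induction m using M.homogeneous_induction with
  | zero => simp
  | add x y hx hy => simp only [smul_add, map_add, hx, hy]
  | hom g x hx =>
    induction a using DirectSum.Decomposition.inductionOn 𝒜 with
    | zero => simp
    | add a b ha hb => simp only [add_smul, map_add, ha, hb]
    | homogeneous a =>
      rw [degreeZeroPart_apply f (M.smul_mem _ _ _ _ a.2 hx), degreeZeroPart_apply f hx, map_smul,
        N.proj_smul _ a.2]

/-- A graded module is projective in the graded category if it is projective as a module. -/
theorem isProjective_of_projective (P : GrMod 𝒜) (hP : Module.Projective A P.carrier) :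
    P.IsProjective := by
  intro M N f g hf
  -- An ungraded lift may mix degrees; its degree zero part is still a lift because f and g preserve
  -- degrees.
  obtain ⟨h, hh⟩ := Module.projective_lifting_property f.toLin g.toLin hf
  refine ⟨⟨{ degreeZeroPart h with map_smul' := degreeZeroPart_smul h }, fun i m hm => ?_⟩, ?_⟩
  · change degreeZeroPart h m ∈ _
    rw [degreeZeroPart_apply h hm]
    exact M.proj_mem _ _
  · ext m
    change f.toLin (degreeZeroPart h m) = g.toLin m
    induction m using P.homogeneous_induction with
    | zero => simp
    | add x y hx hy => simp only [map_add, hx, hy]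
    | hom i x hx =>
      rw [degreeZeroPart_apply h hx, f.map_proj, ← LinearMap.comp_apply, hh,
        N.proj_of_mem (g.map_mem _ _ hx)]

/-- The graded free module with a basis of prescribed degrees. -/
def free (𝒜 : G → σ) [GradedRing 𝒜] {r : ℕ} (deg : Fin r → G) : GrMod 𝒜 where
  carrier := Fin r → A
  comp g :=
    { carrier := {v | ∀ i, v i ∈ 𝒜 (g - deg i)}
      zero_mem' := fun _ => zero_mem _
      add_mem' := fun ha hb i => add_mem (ha i) (hb i)
      neg_mem' := fun ha i => neg_mem (ha i) }
  isInternal := by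
    classical
    refine isInternal_of_projections _ (fun g => AddMonoidHom.mk' (fun v i =>
      (DirectSum.decompose 𝒜 (v i) (g - deg i) : A)) fun v w => ?_) ?_ ?_ ?_ ?_
    · ext i
      simp
    · exact fun g v i => SetLike.coe_mem _
    · intro g v hv
      ext i
      exact DirectSum.decompose_of_mem_same 𝒜 (hv i)
    · intro g h hne v hv
      ext i
      exact DirectSum.decompose_of_mem_ne 𝒜 (hv i) fun h' => hne (sub_left_injective h')
    · intro v
      refine ⟨Finset.univ.biUnion fun i =>
        (DirectSum.decompose 𝒜 (v i)).support.image (· + deg i), ?_⟩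
      ext i
      rw [Finset.sum_apply]
      simp only [AddMonoidHom.mk'_apply]
      conv_rhs => rw [← DirectSum.sum_support_decompose 𝒜 (v i)]
      rw [← Finset.sum_subset (Finset.subset_biUnion_of_mem (fun i =>
        (DirectSum.decompose 𝒜 (v i)).support.image (· + deg i)) (Finset.mem_univ i)),
        Finset.sum_image (fun _ _ _ _ h => add_right_cancel h)]
      · exact Finset.sum_congr rfl fun g _ => by rw [add_sub_cancel_right]
      · intro g _ hg
        by_contra h
        exact hg (Finset.mem_image.2 ⟨g - deg i, by simpa using h, by simp⟩)
  smul_mem g h a v ha hv i := by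
    rw [add_sub_assoc]
    exact SetLike.GradedMul.mul_mem ha (hv i)
  finite := inferInstanceAs (Module.Finite A (Fin r → A))

/-- The kernel of a morphism of graded modules over a Noetherian ring. -/
def ker [IsNoetherianRing A] {M N : GrMod 𝒜} (f : Hom M N) : GrMod 𝒜 where
  carrier := LinearMap.ker f.toLin
  comp g := (M.comp g).comap (LinearMap.ker f.toLin).subtype.toAddMonoidHom
  isInternal := by
    refine isInternal_of_projections _ (fun g =>
      ((M.proj g).comp (LinearMap.ker f.toLin).subtype.toAddMonoidHom).codRestrict
        (LinearMap.ker f.toLin).toAddSubgroup fun m => ?_) ?_ ?_ ?_ ?_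
    · change f.toLin (M.proj g m) = 0
      rw [f.map_proj, LinearMap.mem_ker.1 m.2, map_zero]
    · exact fun g m => M.proj_mem g m
    · exact fun g m hm => Subtype.ext (M.proj_of_mem hm)
    · exact fun g h hne m hm => Subtype.ext (M.proj_of_mem_ne hm hne)
    · intro m
      obtain ⟨s, hs⟩ := M.exists_sum_proj m
      refine ⟨s, Subtype.ext ?_⟩
      rw [AddSubmonoidClass.coe_finsetSum]
      exact hs
  smul_mem g h a m ha hm := M.smul_mem g h a m ha hm
  finite := by
    have := M.finite
    infer_instance

/-- A graded module is a quotient of a graded free module. -/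
theorem exists_free_cover (M : GrMod 𝒜) : ∃ (r : ℕ) (deg : Fin r → G) (q : Hom (free 𝒜 deg) M),
    Function.Surjective q.toLin := by
  classical
  obtain ⟨S, hS⟩ := M.finite
  choose s hs using M.exists_sum_proj
  -- The homogeneous components of a finite set of generators, each tagged with its degree.
  let T : Finset (G × M.carrier) := S.biUnion fun m => (s m).image fun g => (g, M.proj g m)
  have hT : ∀ x ∈ T, x.2 ∈ M.comp x.1 := by
    intro x hx
    obtain ⟨m, _, hm⟩ := Finset.mem_biUnion.1 hx
    obtain ⟨g, _, rfl⟩ := Finset.mem_image.1 hm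
    exact M.proj_mem g m
  let e := T.equivFin
  let q : (Fin T.card → A) →ₗ[A] M.carrier := Fintype.linearCombination A fun i => (e.symm i).1.2
  refine ⟨T.card, fun i => (e.symm i).1.1, ⟨q, fun g v hv => ?_⟩, ?_⟩
  · have hqv : q v = ∑ i, (v : Fin T.card → A) i • (e.symm i).1.2 :=
      Fintype.linearCombination_apply A _ v
    refine hqv.symm ▸ ?_
    refine sum_mem fun i _ => ?_
    have := M.smul_mem _ _ _ _ (hv i) (hT _ (e.symm i).2)
    rwa [sub_add_cancel] at this
  · change Function.Surjective q
    rw [← LinearMap.range_eq_top, Fintype.range_linearCombination, eq_top_iff, ← hS,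
      Submodule.span_le]
    intro m hm
    rw [← hs m]
    refine sum_mem fun g hg => Submodule.subset_span ?_
    have hx : (g, M.proj g m) ∈ T :=
      Finset.mem_biUnion.2 ⟨m, hm, Finset.mem_image.2 ⟨g, hg, rfl⟩⟩
    exact ⟨e ⟨_, hx⟩, by simp⟩

/-- The projective dimension of a graded module in the graded category is bounded by its projective
dimension as a module. -/
theorem projDimLE_of_modPdLE [IsNoetherianRing A] (n : ℕ) (M : GrMod 𝒜)
    (h : ModPdLE A M.carrier n) : ProjDimLE n M := by
  induction n generalizing M with
  | zero => exact M.isProjective_of_projective (modPdLE_zero_iff.1 h)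
  | succ n ih =>
    obtain ⟨r, deg, q, hq⟩ := M.exists_free_cover
    have hfree : Module.Projective A (free 𝒜 deg).carrier :=
      inferInstanceAs (Module.Projective A (Fin r → A))
    let i : Hom (ker q) (free 𝒜 deg) := ⟨(LinearMap.ker q.toLin).subtype, fun g m hm => hm⟩
    have hi : Function.Injective i.toLin := (LinearMap.ker q.toLin).injective_subtype
    have hex : Function.Exact i.toLin q.toLin := LinearMap.exact_subtype_ker_map q.toLin
    exact ⟨free 𝒜 deg, ker q, i, q, isProjective_of_projective _ hfree, hi, hex, hq,
      ih _ (ModPdLE.of_exact_projective i.toLin q.toLin hi hex hq hfree h)⟩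

end GrMod

/-- The hypothesis concerns only the underlying modules, so it can be tested at arbitrary, not
necessarily homogeneous, maximal ideals. -/
theorem isGRegular_of_modPdLE [IsNoetherianRing A] (n : ℕ)
    (h : ∀ M : GrMod 𝒜, ModPdLE A M.carrier n) : IsGRegular 𝒜 :=
  ⟨n, fun M => M.projDimLE_of_modPdLE n (h M)⟩

end GradedModules

end

noncomputable section

/-! ### Comparison of a decomposed module with an extended one. -/

section LocalComparison

open CategoryTheory TensorProduct

/-- Projective dimension does not grow under localization. -/
theorem ModPdLE.localizedModule {A : Type u} [CommRing A] {M : Type u} [AddCommGroup M] [Module A M]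
    {n : ℕ} (h : ModPdLE A M n) (S : Submonoid A) :
    ModPdLE (Localization S) (LocalizedModule S M) n :=
  (h.baseChange (A := Localization S)).of_linearEquiv
    (IsLocalizedModule.isBaseChange S (Localization S) (LocalizedModule.mkLinearMap S M)).equiv

/-- For a finitely generated module over a Noetherian ring, projective dimension can be bounded at
the maximal ideals. -/
theorem modPdLE_of_forall_isMaximal {A : Type u} [CommRing A] [IsNoetherianRing A] {M : Type u}
    [AddCommGroup M] [Module A M] [Module.Finite A M] {n : ℕ}
    (h : ∀ (m : Ideal A) [m.IsMaximal],
      ModPdLE (Localization m.primeCompl) (LocalizedModule m.primeCompl M) n) :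
    ModPdLE A M n := by
  refine ((ModuleCat.of A M).hasProjectiveDimensionLE_iff_forall_maximalSpectrum n).2 fun m => ?_
  have := m.2
  exact ModPdLE.of_linearEquiv (h m.1)
    (Shrink.linearEquiv.{u} (Localization m.1.primeCompl) (LocalizedModule m.1.primeCompl M)).symm

/-- A linear map whose kernel and cokernel are killed by an element of `S` becomes bijective after
localization at `S`. -/
theorem localizedModule_map_bijective {A : Type*} [CommRing A] {M N : Type*} [AddCommGroup M]
    [Module A M] [AddCommGroup N] [Module A N] (S : Submonoid A) (f : M →ₗ[A] N) (u : A)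
    (hu : u ∈ S) (hker : ∀ x, f x = 0 → u • x = 0) (hcoker : ∀ y, ∃ x, f x = u • y) :
    Function.Bijective (LocalizedModule.map S f) := by
  constructor
  · rw [injective_iff_map_eq_zero]
    intro z hz
    induction z using LocalizedModule.induction_on with
    | _ x s =>
      rw [LocalizedModule.map_mk, ← LocalizedModule.zero_mk 1, LocalizedModule.mk_eq] at hz
      obtain ⟨t, ht⟩ := hz
      rw [one_smul, smul_zero, smul_zero] at ht
      have h : f ((t : A) • x) = 0 := by rw [map_smul]; exact ht
      rw [← LocalizedModule.zero_mk 1, LocalizedModule.mk_eq]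
      refine ⟨⟨u, hu⟩ * t, ?_⟩
      rw [one_smul, smul_zero, smul_zero, mul_smul]
      exact hker _ h
  · intro z
    induction z using LocalizedModule.induction_on with
    | _ y s =>
      obtain ⟨x, hx⟩ := hcoker y
      refine ⟨LocalizedModule.mk x (⟨u, hu⟩ * s), ?_⟩
      rw [LocalizedModule.map_mk, hx]
      exact LocalizedModule.mk_cancel_common_left ⟨u, hu⟩ s y

variable {B R A : Type u} [CommRing B] [CommRing R] [CommRing A] [Algebra B R] [Algebra R A]
  [Algebra B A] [IsScalarTower B R A] {K : Type*} [AddCommGroup K] [Fintype K]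
  {M : Type u} [AddCommGroup M] [Module A M] [Module B M] [IsScalarTower B A M]

/-- The elements of `A ⊗ N`, where `A` is a localization of a free `B`-algebra `R`, expressed in
a basis of `R`. -/
theorem exists_smul_eq_sum_basis_tmul {K : Type*} [Fintype K] (S : Submonoid R) [IsLocalization S A]
    (b : Module.Basis K B R) {N : Type*} [AddCommGroup N] [Module B N] (x : A ⊗[B] N) :
    ∃ (s : S) (y : K → N), algebraMap R A s • x = ∑ κ, algebraMap R A (b κ) ⊗ₜ[B] y κ := by
  -- Sums of this shape are stable under R, so two of them can be brought to a common denominator.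
  have hR : ∀ (r : R) (y : K → N), ∃ z : K → N,
      algebraMap R A r • ∑ κ, algebraMap R A (b κ) ⊗ₜ[B] y κ =
        ∑ κ, algebraMap R A (b κ) ⊗ₜ[B] z κ := by
    intro r y
    refine ⟨fun κ => ∑ κ', b.repr (r * b κ') κ • y κ', ?_⟩
    rw [Finset.smul_sum]
    simp only [tmul_sum]
    rw [Finset.sum_comm]
    refine Finset.sum_congr rfl fun κ' _ => ?_
    rw [smul_tmul', smul_eq_mul, ← map_mul]
    conv_lhs => rw [← b.sum_repr (r * b κ'), map_sum, sum_tmul]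
    refine Finset.sum_congr rfl fun κ _ => ?_
    rw [Algebra.smul_def, map_mul, ← IsScalarTower.algebraMap_apply, ← Algebra.smul_def, smul_tmul]
  induction x using TensorProduct.induction_on with
  | zero => exact ⟨1, 0, by simp⟩
  | tmul a m =>
    obtain ⟨⟨r, s⟩, hrs⟩ := IsLocalization.surj S a
    refine ⟨s, fun κ => b.repr r κ • m, ?_⟩
    rw [smul_tmul', smul_eq_mul, mul_comm, hrs]
    conv_lhs => rw [← b.sum_repr r, map_sum, sum_tmul]
    refine Finset.sum_congr rfl fun κ _ => ?_
    rw [Algebra.smul_def, map_mul, ← IsScalarTower.algebraMap_apply, ← Algebra.smul_def, smul_tmul]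
  | add x y hx hy =>
    obtain ⟨s, v, hv⟩ := hx
    obtain ⟨t, w, hw⟩ := hy
    obtain ⟨v', hv'⟩ := hR t v
    obtain ⟨w', hw'⟩ := hR s w
    refine ⟨s * t, v' + w', ?_⟩
    simp only [Pi.add_apply, tmul_add, Finset.sum_add_distrib]
    rw [← hv', ← hw', ← hv, ← hw, smul_smul, smul_smul, ← map_mul, ← map_mul, smul_add,
      Submonoid.coe_mul, mul_comm (t : R)]

/-- A module over a localization of `R` with a decomposition compatible with a basis of `R` over `B`
indexed by a finite group is locally extended from `B`, which bounds its projective dimension. -/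
theorem modPdLE_localizedModule_of_decomposition (S : Submonoid R) [IsLocalization S A]
    (b : Module.Basis K B R) (u : K → B) (hu : ∀ κ, algebraMap B R (u κ) = b κ * b (-κ))
    (Mc : K → Submodule B M)
    (hind : ∀ y : K → M, (∀ κ, y κ ∈ Mc κ) → ∑ κ, y κ = 0 → ∀ κ, y κ = 0)
    (hspan : ∀ m, ∃ y : K → M, (∀ κ, y κ ∈ Mc κ) ∧ ∑ κ, y κ = m)
    (hmul : ∀ κ κ', ∀ m ∈ Mc κ', algebraMap R A (b κ) • m ∈ Mc (κ + κ'))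
    {n : ℕ} (hB : GlobalDimLE B n) (m : Ideal A) [m.IsPrime] (hm : ∀ κ, algebraMap B A (u κ) ∉ m) :
    ModPdLE (Localization m.primeCompl) (LocalizedModule m.primeCompl M) n := by
  classical
  have hflat : Module.Flat B A :=
    have := Module.Free.of_basis b
    have := IsLocalization.flat A S
    Module.Flat.trans B R A
  -- The kernel and cokernel of f are killed by `∏ u κ`, which lies outside m. Hence f becomes an
  -- isomorphism at m, and the flat base change of `Mc 0` has projective dimension at most n.
  let f : A ⊗[B] (Mc 0) →ₗ[A] M := (Mc 0).subtype.liftBaseChange A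
  have hf : ∀ (a : A) (x : Mc 0), f (a ⊗ₜ x) = a • (x : M) := fun a x => rfl
  have huA : ∀ κ, algebraMap B A (u κ) = algebraMap R A (b κ) * algebraMap R A (b (-κ)) := by
    intro κ
    rw [IsScalarTower.algebraMap_apply B R A, hu, map_mul]
  have hdvd : ∀ κ, ∃ c, ∏ κ, algebraMap B A (u κ) = c * algebraMap B A (u κ) := fun κ =>
    ⟨_, (Finset.prod_erase_mul _ _ (Finset.mem_univ κ)).symm⟩
  have hbij := localizedModule_map_bijective m.primeCompl f (∏ κ, algebraMap B A (u κ))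
    (prod_mem fun κ _ => hm κ) ?_ ?_
  · exact ((hB (Mc 0)).baseChange.localizedModule m.primeCompl).of_linearEquiv
      (LinearEquiv.ofBijective _ hbij)
  · intro x hx
    obtain ⟨s, y, hy⟩ := exists_smul_eq_sum_basis_tmul S b x
    have h0 : ∑ κ, algebraMap R A (b κ) • (y κ : M) = 0 := by
      have h := congrArg f hy
      rw [map_smul, hx, smul_zero, map_sum] at h
      exact h.symm
    -- The terms `b κ • y κ` lie in different components, so each vanishes; multiplying by `b (-κ)`
    -- then gives `u κ • y κ = 0`.
    have h1 := hind _ (fun κ => by simpa using hmul κ 0 _ (y κ).2) h0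
    have hs : IsUnit (algebraMap R A s) := IsLocalization.map_units A s
    rw [← hs.smul_eq_zero, smul_comm, hy, Finset.smul_sum]
    refine Finset.sum_eq_zero fun κ _ => ?_
    obtain ⟨c, hc⟩ := hdvd κ
    have h2 : u κ • y κ = 0 := by
      refine Subtype.ext ?_
      change u κ • (y κ : M) = 0
      rw [← algebraMap_smul A (u κ), huA, mul_comm, mul_smul, h1 κ, smul_zero]
    rw [hc, mul_smul, algebraMap_smul, ← tmul_smul, h2, tmul_zero, smul_zero]
  -- For y in `Mc κ`, the element `b (-κ) • y` is in `Mc 0`, and `b κ` carries it to `u κ • y`.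
  · have key : ∀ κ, ∀ y ∈ Mc κ, ∃ x, f x = (∏ κ, algebraMap B A (u κ)) • y := by
      intro κ y hy
      obtain ⟨c, hc⟩ := hdvd κ
      have h0 : algebraMap R A (b (-κ)) • y ∈ Mc 0 := by simpa using hmul (-κ) κ y hy
      refine ⟨(c * algebraMap R A (b κ)) ⊗ₜ ⟨_, h0⟩, ?_⟩
      rw [hf, hc, huA, ← mul_assoc, mul_smul _ _ y]
    intro z
    obtain ⟨y, hy, rfl⟩ := hspan z
    choose x hx using fun κ => key κ (y κ) (hy κ)
    exact ⟨∑ κ, x κ, by rw [map_sum, Finset.smul_sum]; simp only [hx]⟩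

end LocalComparison

end

noncomputable section

namespace GeigleLenzing

open MvPolynomial

/-! ### The degree group and residues of degrees. -/

section LGroup

variable {n : ℕ} (p : Fin n → ℕ)

/-- The universal property of `𝕃`. -/
theorem LGroup.exists_lift {H : Type*} [AddCommGroup H] (x : Fin n → H) (c : H)
    (h : ∀ i, p i • x i = c) :
    ∃ f : LGroup p →+ H, (∀ i, f (LGroup.x p i) = x i) ∧ f (LGroup.c p) = c := by
  let F : ((Fin n → ℤ) × ℤ) →+ H := AddMonoidHom.coprod
    (∑ i, (zmultiplesHom H (x i)).comp (Pi.evalAddMonoidHom (fun _ => ℤ) i)) (zmultiplesHom H c)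
  have hx : ∀ i, F (Pi.single i 1, 0) = x i := by
    intro i
    simp only [F, AddMonoidHom.coprod_apply, AddMonoidHom.finsetSum_apply, map_zero, add_zero]
    rw [Finset.sum_eq_single i]
    · simp
    · intro j _ hj
      simp [Pi.single_eq_of_ne hj]
    · simp
  have hc : F (0, 1) = c := by simp [F]
  refine ⟨QuotientAddGroup.lift _ F ?_, hx, hc⟩
  rw [AddSubgroup.closure_le]
  rintro _ ⟨i, rfl⟩
  simp only [SetLike.mem_coe, AddMonoidHom.mem_ker, map_sub, map_nsmul, hx, hc, h, sub_self]

/-- The group of residues of exponents. -/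
abbrev Residues (q : Fin n → ℕ) : Type := ∀ i, ZMod (q i)

variable (q : Fin n → ℕ) {p}

/-- This relation makes both the residue map on `𝕃` and the map from R to the group algebra well
defined. -/
theorem nsmul_single_residue (hqp : ∀ i, q i ∣ p i) (i : Fin n) :
    p i • (Pi.single i 1 : Residues q) = 0 := by
  rw [← Pi.single_smul, nsmul_one, (ZMod.natCast_eq_zero_iff _ _).2 (hqp i), Pi.single_zero]

theorem sum_val_nsmul_single [∀ i, NeZero (q i)] (κ : Residues q) :
    ∑ i, (κ i).val • (Pi.single i 1 : Residues q) = κ := by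
  simp only [← Pi.single_smul, nsmul_one, ZMod.natCast_zmod_val]
  exact Finset.univ_sum_single κ

/-- The residue of a degree, where `x_i` has residue `e_i` and `c` has residue zero. -/
def residue (hqp : ∀ i, q i ∣ p i) : LGroup p →+ Residues q :=
  (LGroup.exists_lift p (fun i => (Pi.single i 1 : Residues q)) 0
    (nsmul_single_residue q hqp)).choose

theorem residue_x (hqp : ∀ i, q i ∣ p i) (i : Fin n) :
    residue q hqp (LGroup.x p i) = Pi.single i 1 :=
  (LGroup.exists_lift p (fun i => (Pi.single i 1 : Residues q)) 0
    (nsmul_single_residue q hqp)).choose_spec.1 i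

theorem residue_c (hqp : ∀ i, q i ∣ p i) : residue q hqp (LGroup.c p) = 0 :=
  (LGroup.exists_lift p (fun i => (Pi.single i 1 : Residues q)) 0
    (nsmul_single_residue q hqp)).choose_spec.2

end LGroup

/-! ### Representation of R in a group algebra over an algebraically closed field. -/

section Embedding

variable {k : Type u} [Field k] {d n : ℕ} (lam : Fin n → Fin (d + 1) → k) (p q : Fin n → ℕ)

/-- The linear form with given coefficients, as a polynomial in `T_0, …, T_d`. -/
def form (v : Fin (d + 1) → k) : MvPolynomial (Fin (d + 1)) k :=
  ∑ j, C (v j) * X j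

theorem form_isHomogeneous (v : Fin (d + 1) → k) : (form v).IsHomogeneous 1 :=
  IsHomogeneous.sum _ _ _ fun j _ => (isHomogeneous_X k j).C_mul (v j)

theorem coeff_form (v : Fin (d + 1) → k) (j : Fin (d + 1)) :
    (form v).coeff (Finsupp.single j 1) = v j := by
  simp [form, coeff_sum, coeff_C_mul, coeff_X, Finsupp.single_left_inj]

theorem form_ne_zero {v : Fin (d + 1) → k} (hv : v ≠ 0) : form v ≠ 0 := by
  intro h
  refine hv (funext fun j => ?_)
  rw [← coeff_form v j, h, coeff_zero, Pi.zero_apply]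

/-- The image of the variable `X_i` in `R`. -/
def varX (i : Fin n) : GLRing lam p := Ideal.Quotient.mk (relIdeal lam p) (X (Sum.inr i))

/-- The inclusion of the polynomial ring in `T_0, …, T_d` into `R`. -/
def incl : MvPolynomial (Fin (d + 1)) k →ₐ[k] GLRing lam p := aeval (varT lam p)

theorem incl_X (j : Fin (d + 1)) : incl lam p (X j) = varT lam p j := aeval_X _ _

theorem linForm_eq_rename (i : Fin n) :
    linForm lam i = rename Sum.inl (form (lam i)) := by
  simp [form, linForm]

theorem incl_eq_rename (f : MvPolynomial (Fin (d + 1)) k) :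
    incl lam p f = Ideal.Quotient.mk (relIdeal lam p) (rename Sum.inl f) := by
  have h : incl lam p = (Ideal.Quotient.mkₐ k (relIdeal lam p)).comp (rename Sum.inl) := by
    refine MvPolynomial.algHom_ext fun j => ?_
    rw [incl_X, AlgHom.comp_apply, rename_X]
    rfl
  exact DFunLike.congr_fun h f

theorem incl_form (i : Fin n) : incl lam p (form (lam i)) = varX lam p i ^ p i := by
  rw [incl_eq_rename, ← linForm_eq_rename, varX, ← map_pow, eq_comm, Ideal.Quotient.eq]
  exact Ideal.subset_span ⟨i, rfl⟩

/-- The monomial in the `X_i` with a given family of residues of exponents. -/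
def monoX (κ : Residues q) : GLRing lam p := ∏ i, varX lam p i ^ (κ i).val

/-- An algebraic closure of the field of fractions of the polynomial ring in `T_0, …, T_d`. -/
abbrev RootField (k : Type u) [Field k] (d : ℕ) : Type u :=
  AlgebraicClosure (FractionRing (MvPolynomial (Fin (d + 1)) k))

/-- The inclusion of polynomials into the algebraically closed field. -/
def toRootField (k : Type u) [Field k] (d : ℕ) :
    MvPolynomial (Fin (d + 1)) k →ₐ[k] RootField k d :=
  (IsScalarTower.toAlgHom k (FractionRing (MvPolynomial (Fin (d + 1)) k)) (RootField k d)).comp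
    (IsScalarTower.toAlgHom k (MvPolynomial (Fin (d + 1)) k) _)

theorem toRootField_injective : Function.Injective (toRootField k d) :=
  (FaithfulSMul.algebraMap_injective (FractionRing (MvPolynomial (Fin (d + 1)) k))
    (RootField k d)).comp (IsFractionRing.injective _ _)

variable [∀ i, NeZero (p i)]

/-- A `p_i`-th root of `ℓ_i`. -/
def root (i : Fin n) : RootField k d :=
  (IsAlgClosed.exists_pow_nat_eq (toRootField k d (form (lam i)))
    (Nat.pos_of_ne_zero (NeZero.ne (p i)))).choose

theorem root_pow (i : Fin n) : root lam p i ^ p i = toRootField k d (form (lam i)) :=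
  (IsAlgClosed.exists_pow_nat_eq (toRootField k d (form (lam i)))
    (Nat.pos_of_ne_zero (NeZero.ne (p i)))).choose_spec

theorem root_ne_zero {i : Fin n} (h : lam i ≠ 0) : root lam p i ≠ 0 := by
  intro h0
  have h1 := root_pow lam p i
  rw [h0, zero_pow (NeZero.ne _), eq_comm, map_eq_zero_iff _ toRootField_injective] at h1
  exact form_ne_zero h h1

variable {p}

/-- The images of the variables in the group algebra. -/
def generatorImage : Fin (d + 1) ⊕ Fin n → AddMonoidAlgebra (RootField k d) (Residues q) :=
  Sum.elim (fun j => AddMonoidAlgebra.single 0 (toRootField k d (X j)))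
    fun i => AddMonoidAlgebra.single (Pi.single i 1) (root lam p i)

theorem aeval_generatorImage_rename (f : MvPolynomial (Fin (d + 1)) k) :
    aeval (generatorImage (p := p) lam q) (rename Sum.inl f) =
      AddMonoidAlgebra.single 0 (toRootField k d f) := by
  have h : (aeval (generatorImage (p := p) lam q)).comp (rename Sum.inl) =
      (AddMonoidAlgebra.singleZeroAlgHom (R := k) (A := RootField k d)
        (M := Residues q)).comp (toRootField k d) := by
    refine MvPolynomial.algHom_ext fun j => ?_
    rw [AlgHom.comp_apply, rename_X, aeval_X]
    rfl
  exact DFunLike.congr_fun h f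

/-- The map from `R` to a group algebra over a field, sending `X_i` to a `p_i`-th root of `ℓ_i`
times the group element `e_i`. -/
def toGroupAlgebra (hqp : ∀ i, q i ∣ p i) :
    GLRing lam p →ₐ[k] AddMonoidAlgebra (RootField k d) (Residues q) :=
  Ideal.Quotient.liftₐ _ (aeval (generatorImage (p := p) lam q)) <| by
    intro a ha
    rw [← RingHom.mem_ker]
    refine (Ideal.span_le.2 ?_ : relIdeal lam p ≤ _) ha
    rintro _ ⟨i, rfl⟩
    rw [SetLike.mem_coe, RingHom.mem_ker, map_sub, map_pow, aeval_X, linForm_eq_rename,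
      aeval_generatorImage_rename, generatorImage, Sum.elim_inr, AddMonoidAlgebra.single_pow,
      nsmul_single_residue q hqp, root_pow, sub_self]

theorem toGroupAlgebra_varX (hqp : ∀ i, q i ∣ p i) (i : Fin n) :
    toGroupAlgebra lam q hqp (varX lam p i) =
      AddMonoidAlgebra.single (Pi.single i 1) (root lam p i) :=
  aeval_X (generatorImage (p := p) lam q) (Sum.inr i)

theorem toGroupAlgebra_incl (hqp : ∀ i, q i ∣ p i) (f : MvPolynomial (Fin (d + 1)) k) :
    toGroupAlgebra lam q hqp (incl lam p f) = AddMonoidAlgebra.single 0 (toRootField k d f) := by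
  rw [incl_eq_rename]
  exact aeval_generatorImage_rename lam q f

/-- Different κ land on different group elements, so the coefficient at κ isolates the contribution
of one monomial. -/
theorem toGroupAlgebra_monoX [∀ i, NeZero (q i)] (hqp : ∀ i, q i ∣ p i) (κ : Residues q) :
    toGroupAlgebra lam q hqp (monoX lam p q κ) =
      AddMonoidAlgebra.single κ (∏ i, root lam p i ^ (κ i).val) := by
  conv_rhs => rw [← sum_val_nsmul_single q κ]
  simp only [monoX, map_prod, map_pow, toGroupAlgebra_varX, AddMonoidAlgebra.single_pow,
    AddMonoidAlgebra.prod_single, sum_val_nsmul_single]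

end Embedding

end GeigleLenzing

end

noncomputable section

namespace GeigleLenzing

open MvPolynomial

/-! ### Normal forms and monomial bases. -/

section NormalForm

variable {k : Type u} [Field k] {d n : ℕ} (lam : Fin n → Fin (d + 1) → k) (p q : Fin n → ℕ)

theorem mk_monomial (b : Fin (d + 1) ⊕ Fin n →₀ ℕ) (c : k) :
    Ideal.Quotient.mk (relIdeal lam p) (monomial b c) =
      algebraMap k (GLRing lam p) c * (∏ j, varT lam p j ^ b (Sum.inl j)) *
        ∏ i, varX lam p i ^ b (Sum.inr i) := by
  rw [monomial_eq, Finsupp.prod_fintype _ _ (fun _ => pow_zero _), Fintype.prod_sum_type, map_mul,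
    map_mul, map_prod, map_prod, ← mul_assoc]
  simp only [map_pow]
  rfl

/-- Division with remainder of every exponent by `q i`. For `q = p`, the quotient part is a product
of powers of the `ℓ_i`. -/
theorem prod_varX_pow [∀ i, NeZero (q i)] (e : Fin n → ℕ) :
    ∏ i, varX lam p i ^ e i =
      monoX lam p q (fun i => (e i : ZMod (q i))) * ∏ i, (varX lam p i ^ q i) ^ (e i / q i) := by
  rw [monoX, ← Finset.prod_mul_distrib]
  refine Finset.prod_congr rfl fun i _ => ?_
  rw [ZMod.val_natCast, ← pow_mul, ← pow_add, Nat.mod_add_div]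

theorem weight_varDeg (b : Fin (d + 1) ⊕ Fin n →₀ ℕ) :
    Finsupp.weight (varDeg d p) b = (∑ j, b (Sum.inl j)) • LGroup.c p +
      ∑ i, b (Sum.inr i) • LGroup.x p i := by
  rw [Finsupp.weight_apply, Finsupp.sum_fintype _ _ (fun i => zero_smul ℕ (varDeg d p i)),
    Fintype.sum_sum_type, Finset.sum_smul]
  rfl

variable {p}

theorem residue_weight (hqp : ∀ i, q i ∣ p i) (b : Fin (d + 1) ⊕ Fin n →₀ ℕ) :
    residue q hqp (Finsupp.weight (varDeg d p) b) = fun i => (b (Sum.inr i) : ZMod (q i)) := by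
  rw [weight_varDeg, map_add, map_nsmul, residue_c, smul_zero, zero_add, map_sum]
  simp only [map_nsmul, residue_x, ← Pi.single_smul, nsmul_one]
  exact Finset.univ_sum_single _

variable [∀ i, NeZero (p i)]

/-- A rational degree in which `T_j` counts 1 and `X_i` counts `1 / p_i`; it shows that the
polynomial part of a normal form is homogeneous. -/
theorem exists_degree_map : ∃ δ : LGroup p →+ ℚ, (∀ i, δ (LGroup.x p i) = (p i : ℚ)⁻¹) ∧
    δ (LGroup.c p) = 1 :=
  LGroup.exists_lift p _ _ fun i => by
    rw [nsmul_eq_mul, mul_inv_cancel₀ (Nat.cast_ne_zero.2 (NeZero.ne _))]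

variable (p) in
/-- The residue of a degree modulo the full family of exponents. -/
abbrev fullResidue : LGroup p →+ Residues p := residue p fun i => dvd_refl (p i)

/-- Every homogeneous element of `R` is a monomial in the `X_i`, determined by the degree, times a
homogeneous polynomial in the `T_j`. -/
theorem exists_eq_monoX_mul_incl {g : LGroup p} {a : GLRing lam p} (ha : a ∈ gradingR lam p g) :
    ∃ (m : ℕ) (f : MvPolynomial (Fin (d + 1)) k), f.IsHomogeneous m ∧
      a = monoX lam p p (fullResidue p g) * incl lam p f := by
  obtain ⟨s, hs, rfl⟩ := ha
  obtain ⟨δ, hδx, hδc⟩ := exists_degree_map (p := p)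
  -- The rational degree left after removing the monomial. It is already a natural number as soon as
  -- a monomial of degree g occurs; otherwise the element is zero and the value is irrelevant.
  refine ⟨⌊δ g - ∑ i, ((fullResidue p g i).val : ℚ) * (p i : ℚ)⁻¹⌋₊, ?_⟩
  set N := ⌊δ g - ∑ i, ((fullResidue p g i).val : ℚ) * (p i : ℚ)⁻¹⌋₊ with hN
  have hmon : ∀ b ∈ s.support, ∃ f : MvPolynomial (Fin (d + 1)) k, f.IsHomogeneous N ∧
      Ideal.Quotient.mk (relIdeal lam p) (monomial b (s.coeff b)) =
        monoX lam p p (fullResidue p g) * incl lam p f := by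
    intro b hb
    have hw : Finsupp.weight (varDeg d p) b = g := hs (mem_support_iff.1 hb)
    have hres : fullResidue p g = fun i => (b (Sum.inr i) : ZMod (p i)) := by
      rw [← hw, residue_weight]
    have hdeg : ∑ j, b (Sum.inl j) + ∑ i, b (Sum.inr i) / p i = N := by
      have h1 : δ g - ∑ i, ((fullResidue p g i).val : ℚ) * (p i : ℚ)⁻¹ =
          ((∑ j, b (Sum.inl j) + ∑ i, b (Sum.inr i) / p i : ℕ) : ℚ) := by
        have h2 : ∀ i, (b (Sum.inr i) : ℚ) * (p i : ℚ)⁻¹ =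
            ((b (Sum.inr i) % p i : ℕ) : ℚ) * (p i : ℚ)⁻¹ + ((b (Sum.inr i) / p i : ℕ) : ℚ) := by
          intro i
          have hp0 : (p i : ℚ) ≠ 0 := Nat.cast_ne_zero.2 (NeZero.ne _)
          conv_lhs => rw [← Nat.mod_add_div (b (Sum.inr i)) (p i)]
          push_cast
          field_simp
        rw [hres, ← hw, weight_varDeg, map_add, map_nsmul, hδc, map_sum]
        simp only [map_nsmul, hδx, ZMod.val_natCast, nsmul_eq_mul, h2, Finset.sum_add_distrib]
        push_cast
        ring
      rw [hN, h1, Nat.floor_natCast]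
    refine ⟨C (s.coeff b) * (∏ j, X j ^ b (Sum.inl j)) *
      ∏ i, form (lam i) ^ (b (Sum.inr i) / p i), ?_, ?_⟩
    · rw [← hdeg]
      refine IsHomogeneous.mul (IsHomogeneous.C_mul (IsHomogeneous.prod _ _ _ fun j _ => ?_) _)
        (IsHomogeneous.prod _ _ _ fun i _ => ?_)
      · simpa using (isHomogeneous_X k j).pow (b (Sum.inl j))
      · simpa using (form_isHomogeneous (lam i)).pow (b (Sum.inr i) / p i)
    · rw [mk_monomial, prod_varX_pow lam p p, hres]
      simp only [map_mul, map_prod, map_pow, incl_X, incl_form, algHom_C]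
      ring
  choose! f hf hfm using hmon
  refine ⟨∑ b ∈ s.support, f b, IsHomogeneous.sum _ _ _ hf, ?_⟩
  conv_lhs => rw [s.as_sum]
  rw [map_sum, map_sum, Finset.mul_sum]
  exact Finset.sum_congr rfl hfm

variable {lam}

theorem prod_root_pow_ne_zero (hlam : ∀ i, lam i ≠ 0) (e : Fin n → ℕ) :
    ∏ i, root lam p i ^ e i ≠ 0 :=
  Finset.prod_ne_zero_iff.2 fun i _ => pow_ne_zero _ (root_ne_zero lam p (hlam i))

variable {q} in
/-- The monomials in the `X_i` with bounded exponents form a basis of `R` over a subring. -/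
theorem exists_basis_monoX [∀ i, NeZero (q i)] (hqp : ∀ i, q i ∣ p i) (hlam : ∀ i, lam i ≠ 0)
    {B : Type*} [CommRing B] [Algebra k B] [Algebra B (GLRing lam p)]
    [IsScalarTower k B (GLRing lam p)]
    (hT : ∀ j, varT lam p j ∈ (algebraMap B (GLRing lam p)).range)
    (hX : ∀ i, varX lam p i ^ q i ∈ (algebraMap B (GLRing lam p)).range)
    (β : B → RootField k d) (hβ : ∀ b, β b = 0 → b = 0)
    (hβq : ∀ b, toGroupAlgebra lam q hqp (algebraMap B (GLRing lam p) b) =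
      AddMonoidAlgebra.single 0 (β b)) :
    ∃ b : Module.Basis (Residues q) B (GLRing lam p), ∀ κ, b κ = monoX lam p q κ := by
  have hli : LinearIndependent B (monoX lam p q) := by
    rw [Fintype.linearIndependent_iff]
    intro c hc κ
    -- The coefficient at κ of the image of the relation is `β (c κ)` times a non-zero product of
    -- roots.
    have h := congrArg (toGroupAlgebra lam q hqp) hc
    simp only [map_sum, map_zero, Algebra.smul_def, map_mul, hβq, toGroupAlgebra_monoX,
      AddMonoidAlgebra.single_mul_single, zero_add] at h
    have h1 := congrArg (fun x => x.coeff κ) h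
    simp only [AddMonoidAlgebra.coeff_sum, AddMonoidAlgebra.coeff_single, Finsupp.finsetSum_apply,
      AddMonoidAlgebra.coeff_zero, Finsupp.coe_zero, Pi.zero_apply] at h1
    rw [Finset.sum_eq_single κ (fun κ' _ hne => Finsupp.single_eq_of_ne' hne)
      (fun h => absurd (Finset.mem_univ κ) h), Finsupp.single_eq_same] at h1
    exact hβ _ ((mul_eq_zero.1 h1).resolve_right (prod_root_pow_ne_zero hlam _))
  have hsp : ⊤ ≤ Submodule.span B (Set.range (monoX lam p q)) := by
    rintro a -
    obtain ⟨s, rfl⟩ := Ideal.Quotient.mk_surjective a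
    rw [s.as_sum, map_sum]
    refine sum_mem fun b _ => ?_
    have hc : algebraMap k (GLRing lam p) (s.coeff b) ∈ (algebraMap B (GLRing lam p)).range :=
      ⟨algebraMap k B (s.coeff b), (IsScalarTower.algebraMap_apply _ _ _ _).symm⟩
    obtain ⟨z, hz⟩ := mul_mem (mul_mem hc (prod_mem fun j (_ : j ∈ Finset.univ) =>
      pow_mem (hT j) (b (Sum.inl j)))) (prod_mem fun i (_ : i ∈ Finset.univ) =>
      pow_mem (hX i) (b (Sum.inr i) / q i))
    rw [mk_monomial, prod_varX_pow lam p q, mul_left_comm, ← hz, mul_comm, ← Algebra.smul_def]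
    exact Submodule.smul_mem _ _ (Submodule.subset_span ⟨_, rfl⟩)
  exact ⟨Module.Basis.mk hli hsp, fun κ => Module.Basis.mk_apply hli hsp κ⟩

end NormalForm

/-! ### R is a graded domain. -/

section Domain

variable {k : Type u} [Field k] {d n : ℕ} {lam : Fin n → Fin (d + 1) → k} {p : Fin n → ℕ}
  [∀ i, NeZero (p i)]

theorem toGroupAlgebra_monoX_mul_incl (κ : Residues p) (f : MvPolynomial (Fin (d + 1)) k) :
    toGroupAlgebra lam p (fun i => dvd_refl (p i)) (monoX lam p p κ * incl lam p f) =
      AddMonoidAlgebra.single κ ((∏ i, root lam p i ^ (κ i).val) * toRootField k d f) := by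
  rw [map_mul, toGroupAlgebra_monoX, toGroupAlgebra_incl, AddMonoidAlgebra.single_mul_single,
    add_zero]

theorem isGDomain_gradingR (hlam : ∀ i, lam i ≠ 0) : IsGDomain (gradingR lam p) := by
  refine ⟨(toGroupAlgebra lam p (fun i => dvd_refl (p i))).toRingHom.domain_nontrivial, ?_⟩
  rintro a b ⟨g, ha⟩ ⟨h, hb⟩ ha0 hb0 hab
  obtain ⟨m, f, -, rfl⟩ := exists_eq_monoX_mul_incl lam ha
  obtain ⟨m', f', -, rfl⟩ := exists_eq_monoX_mul_incl lam hb
  have hf : f ≠ 0 := by rintro rfl; simp at ha0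
  have hf' : f' ≠ 0 := by rintro rfl; simp at hb0
  have h1 := congrArg (toGroupAlgebra lam p (fun i => dvd_refl (p i))) hab
  rw [map_mul, toGroupAlgebra_monoX_mul_incl, toGroupAlgebra_monoX_mul_incl,
    AddMonoidAlgebra.single_mul_single, map_zero, AddMonoidAlgebra.single_eq_zero] at h1
  have hz : ∀ f : MvPolynomial (Fin (d + 1)) k, f ≠ 0 → toRootField k d f ≠ 0 := fun f hf =>
    (map_ne_zero_iff _ toRootField_injective).2 hf
  exact mul_ne_zero (mul_ne_zero (prod_root_pow_ne_zero hlam _) (hz f hf))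
    (mul_ne_zero (prod_root_pow_ne_zero hlam _) (hz f' hf')) h1

end Domain

end GeigleLenzing

end

noncomputable section

/-! ### Factors of homogeneous polynomials. -/

section HomogeneousFactors

open MvPolynomial

variable {ι k : Type*} [Field k]

/-- The substitution multiplying all variables by a new variable. -/
def homogenizingMap (ι k : Type*) [Field k] :
    MvPolynomial ι k →ₐ[k] Polynomial (MvPolynomial ι k) :=
  aeval fun j => Polynomial.C (X j) * Polynomial.X

/-- This turns homogeneity into a one-variable condition: a non-zero f is homogeneous exactly when
its image has a single non-zero coefficient. -/
theorem coeff_homogenizingMap (f : MvPolynomial ι k) (m : ℕ) :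
    (homogenizingMap ι k f).coeff m = homogeneousComponent m f := by
  classical
  induction f using MvPolynomial.induction_on' with
  | add f g hf hg => rw [map_add, Polynomial.coeff_add, hf, hg, map_add]
  | monomial b c =>
    have h : homogenizingMap ι k (monomial b c) =
        Polynomial.C (monomial b c) * Polynomial.X ^ b.degree := by
      rw [homogenizingMap, aeval_monomial, monomial_eq, Finsupp.prod, Finsupp.prod,
        Finsupp.degree_apply, ← Finset.prod_pow_eq_pow_sum]
      simp only [mul_pow, Finset.prod_mul_distrib, map_mul, map_prod, map_pow, mul_assoc]
      rfl
    rw [h, Polynomial.coeff_C_mul_X_pow]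
    split_ifs with hm
    · rw [homogeneousComponent_of_mem (isHomogeneous_monomial c hm.symm), if_pos rfl]
    · rw [homogeneousComponent_of_mem (isHomogeneous_monomial c rfl), if_neg hm]

/-- A factor of a non-zero homogeneous polynomial is homogeneous. -/
theorem MvPolynomial.IsHomogeneous.exists_of_mul {f g : MvPolynomial ι k} {N : ℕ}
    (h : (f * g).IsHomogeneous N) (h0 : f * g ≠ 0) : ∃ m, f.IsHomogeneous m := by
  classical
  have hfg : homogenizingMap ι k (f * g) = Polynomial.C (f * g) * Polynomial.X ^ N := by
    ext1 m
    rw [coeff_homogenizingMap, homogeneousComponent_of_mem h, Polynomial.coeff_C_mul_X_pow]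
  have hne : homogenizingMap ι k f * homogenizingMap ι k g ≠ 0 := by
    rw [← map_mul, hfg]
    exact mul_ne_zero (Polynomial.C_ne_zero.2 h0) (pow_ne_zero _ Polynomial.X_ne_zero)
  -- Degree and trailing degree are both additive and coincide for the product, so they coincide for
  -- each factor.
  have h1 := Polynomial.natDegree_mul (left_ne_zero_of_mul hne) (right_ne_zero_of_mul hne)
  have h2 := Polynomial.natTrailingDegree_mul (left_ne_zero_of_mul hne) (right_ne_zero_of_mul hne)
  rw [← map_mul, hfg, Polynomial.natDegree_C_mul_X_pow _ _ h0] at h1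
  rw [← map_mul, hfg, Polynomial.natTrailingDegree_mul_X_pow (Polynomial.C_ne_zero.2 h0),
    Polynomial.natTrailingDegree_C, zero_add] at h2
  have h3 := Polynomial.natTrailingDegree_le_natDegree (homogenizingMap ι k f)
  have h4 := Polynomial.natTrailingDegree_le_natDegree (homogenizingMap ι k g)
  refine ⟨(homogenizingMap ι k f).natDegree, ?_⟩
  have hcomp : ∀ m, m ≠ (homogenizingMap ι k f).natDegree → homogeneousComponent m f = 0 := by
    intro m hm
    rw [← coeff_homogenizingMap]
    rcases lt_or_gt_of_ne hm with hlt | hgt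
    · exact Polynomial.coeff_eq_zero_of_lt_natTrailingDegree (by omega)
    · exact Polynomial.coeff_eq_zero_of_natDegree_lt hgt
  have hsum : (∑ i ∈ Finset.range (f.totalDegree + 1), homogeneousComponent i f).IsHomogeneous
      (homogenizingMap ι k f).natDegree := by
    refine IsHomogeneous.sum _ _ _ fun m _ => ?_
    by_cases hm : m = (homogenizingMap ι k f).natDegree
    · rw [hm]
      exact homogeneousComponent_isHomogeneous _ _
    · rw [hcomp m hm]
      exact isHomogeneous_zero _ _ _
  rwa [sum_homogeneousComponent] at hsum

end HomogeneousFactors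

section Prime

variable {G : Type*} [AddCommGroup G] [DecidableEq G] {A : Type u} [CommRing A]
variable {σ : Type*} [SetLike σ A] [AddSubgroupClass σ A] {𝒜 : G → σ} [GradedRing 𝒜]

theorem isGPrime_of_mul_mem {I : Ideal A} (hI : I.IsHomogeneous 𝒜) (h1 : I ≠ ⊤)
    (h : ∀ a b, SetLike.IsHomogeneousElem 𝒜 a → SetLike.IsHomogeneousElem 𝒜 b → a * b ∈ I →
      a ∈ I ∨ b ∈ I) : IsGPrime 𝒜 I := by
  refine ⟨hI, Ideal.Quotient.nontrivial_iff.2 h1, ?_⟩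
  rintro _ _ ⟨i, a, ha, rfl⟩ ⟨j, b, hb, rfl⟩ ha0 hb0 hab
  rw [← map_mul, Ideal.Quotient.eq_zero_iff_mem] at hab
  rcases h a b ⟨i, ha⟩ ⟨j, hb⟩ hab with h | h
  · exact ha0 (Ideal.Quotient.eq_zero_iff_mem.2 h)
  · exact hb0 (Ideal.Quotient.eq_zero_iff_mem.2 h)

theorem isGPrimeElem_of_dvd {c : A} (hc : SetLike.IsHomogeneousElem 𝒜 c) (h0 : c ≠ 0)
    (h1 : ¬ c ∣ 1) (h : ∀ a b, SetLike.IsHomogeneousElem 𝒜 a → SetLike.IsHomogeneousElem 𝒜 b →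
      c ∣ a * b → c ∣ a ∨ c ∣ b) : IsGPrimeElem 𝒜 c := by
  refine ⟨hc, h0, isGPrime_of_mul_mem (Ideal.homogeneous_span 𝒜 _ ?_) ?_ ?_⟩
  · rintro _ rfl
    exact hc
  · rwa [Ne, Ideal.eq_top_iff_one, Ideal.mem_span_singleton]
  · simpa only [Ideal.mem_span_singleton] using h

end Prime

theorem span_singleton_smul {k A : Type*} [Field k] [CommRing A] [Algebra k A] {c : k} (hc : c ≠ 0)
    (a : A) : Ideal.span {c • a} = Ideal.span {a} := by
  rw [Algebra.smul_def]
  exact Ideal.span_singleton_mul_left_unit ((isUnit_iff_ne_zero.2 hc).map _) _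

namespace GeigleLenzing

open MvPolynomial

/-! ### Linear forms as primes of the polynomial ring. -/

section Forms

variable {k : Type u} [Field k] {d : ℕ}

theorem form_irreducible {v : Fin (d + 1) → k} (hv : v ≠ 0) : Irreducible (form v) := by
  refine irreducible_of_totalDegree_eq_one
    ((form_isHomogeneous v).totalDegree (form_ne_zero hv)) fun x hx => ?_
  obtain ⟨j, hj⟩ := Function.ne_iff.1 hv
  refine isUnit_iff_ne_zero.2 ?_
  rintro rfl
  exact hj (by simpa [coeff_form] using hx (Finsupp.single j 1))

theorem form_prime {v : Fin (d + 1) → k} (hv : v ≠ 0) : Prime (form v) :=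
  (form_irreducible hv).prime

theorem exists_C_of_isUnit {f : MvPolynomial (Fin (d + 1)) k} (hf : IsUnit f) :
    ∃ c : k, c ≠ 0 ∧ f = C c := by
  obtain ⟨h1, h2⟩ := MvPolynomial.isUnit_iff_totalDegree_of_isReduced.1 hf
  exact ⟨_, h1.ne_zero, totalDegree_eq_zero_iff_eq_C.1 h2⟩

/-- Irreducible elements dividing one another are associated, and the units of `k[T]` are constants,
so v and w are proportional. -/
theorem not_linearIndependent_of_form_dvd {v w : Fin (d + 1) → k} (hv : v ≠ 0) (hw : w ≠ 0)
    (h : form v ∣ form w) : ¬ LinearIndependent k ![v, w] := by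
  obtain ⟨u, hu⟩ := (form_irreducible hv).associated_of_dvd (form_irreducible hw) h
  obtain ⟨c, hc, hcu⟩ := exists_C_of_isUnit u.isUnit
  intro hli
  have h1 := LinearIndependent.pair_iff.1 hli c (-1) (funext fun j => by
    rw [Pi.add_apply, Pi.smul_apply, Pi.smul_apply, Pi.zero_apply, ← coeff_form w j, ← hu, hcu,
      mul_comm, coeff_C_mul, coeff_form, smul_eq_mul, smul_eq_mul]
    ring)
  exact hc h1.1

end Forms

/-! ### Graded primes of R and graded factoriality. -/

section Factorial

variable {k : Type u} [Field k] {d n : ℕ} {lam : Fin n → Fin (d + 1) → k} {p : Fin n → ℕ}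

theorem incl_mem_gradingR {m : ℕ} {f : MvPolynomial (Fin (d + 1)) k} (hf : f.IsHomogeneous m) :
    incl lam p f ∈ gradingR lam p (m • LGroup.c p) := by
  rw [f.as_sum, map_sum]
  refine sum_mem fun b hb => ⟨rename Sum.inl (monomial b (f.coeff b)), ?_,
    (incl_eq_rename lam p _).symm⟩
  rw [rename_monomial]
  refine isWeightedHomogeneous_monomial _ _ _ ?_
  have hd : b.degree = m := by
    rw [Finsupp.degree_eq_weight_one]
    exact hf (mem_support_iff.1 hb)
  rw [weight_varDeg, ← hd, Finsupp.degree_eq_sum]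
  simp [Finsupp.mapDomain_apply Sum.inl_injective, Finsupp.mapDomain_of_notMem_range]

theorem varX_mem_gradingR (i : Fin n) : varX lam p i ∈ gradingR lam p (LGroup.x p i) :=
  ⟨X (Sum.inr i), isWeightedHomogeneous_X k (varDeg d p) (Sum.inr i), rfl⟩

theorem monoX_zero (q : Fin n → ℕ) : monoX lam p q 0 = 1 := by simp [monoX]

variable [∀ i, NeZero (p i)]

/-- The carries occurring in the sum of two residues. -/
def carry (κ κ' : Residues p) (i : Fin n) : ℕ := ((κ i).val + (κ' i).val) / p i

/-- In the primality proof for `X_i`, this removes `ℓ_i` from the product of carries. -/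
theorem carry_eq_zero {κ κ' : Residues p} {i : Fin n} (h : κ i = 0) : carry κ κ' i = 0 := by
  rw [carry, h, ZMod.val_zero, zero_add]
  exact Nat.div_eq_of_lt (ZMod.val_lt _)

/-- Each carry in the i-th exponent trades `X_i ^ p_i` for `ℓ_i`. -/
theorem monoX_mul_monoX (κ κ' : Residues p) :
    monoX lam p p κ * monoX lam p p κ' =
      monoX lam p p (κ + κ') * incl lam p (∏ i, form (lam i) ^ carry κ κ' i) := by
  have h : monoX lam p p κ * monoX lam p p κ' =
      ∏ i, varX lam p i ^ ((κ i).val + (κ' i).val) := by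
    simp only [monoX, ← Finset.prod_mul_distrib, pow_add]
  rw [h, prod_varX_pow lam p p, map_prod]
  simp only [map_pow, incl_form, Nat.cast_add, ZMod.natCast_zmod_val]
  rfl

theorem mul_normalForms (κ κ' : Residues p) (f f' : MvPolynomial (Fin (d + 1)) k) :
    (monoX lam p p κ * incl lam p f) * (monoX lam p p κ' * incl lam p f') =
      monoX lam p p (κ + κ') * incl lam p ((∏ i, form (lam i) ^ carry κ κ' i) * (f * f')) := by
  rw [mul_mul_mul_comm, monoX_mul_monoX, map_mul, map_mul, mul_assoc]

theorem exists_eq_sum_monoX_mul_incl (hlam : ∀ i, lam i ≠ 0) (r : GLRing lam p) :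
    ∃ h : Residues p → MvPolynomial (Fin (d + 1)) k,
      r = ∑ κ, monoX lam p p κ * incl lam p (h κ) := by
  let _ : Algebra (MvPolynomial (Fin (d + 1)) k) (GLRing lam p) := (incl lam p).toRingHom.toAlgebra
  let _ : Module (MvPolynomial (Fin (d + 1)) k) (GLRing lam p) := Algebra.toModule
  have : IsScalarTower k (MvPolynomial (Fin (d + 1)) k) (GLRing lam p) :=
    IsScalarTower.of_algebraMap_eq fun c => ((incl lam p).commutes c).symm
  obtain ⟨b, hb⟩ := exists_basis_monoX (fun i => dvd_refl (p i)) hlam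
    (B := MvPolynomial (Fin (d + 1)) k) (fun j => ⟨X j, incl_X lam p j⟩)
    (fun i => ⟨form (lam i), incl_form lam p i⟩) (toRootField k d)
    (fun f hf => (map_eq_zero_iff _ toRootField_injective).1 hf)
    (fun f => toGroupAlgebra_incl lam p _ f)
  refine ⟨fun κ => b.repr r κ, ?_⟩
  conv_lhs => rw [← b.sum_repr r]
  refine Finset.sum_congr rfl fun κ _ => ?_
  rw [Algebra.smul_def, hb, mul_comm]
  rfl

/-- Expand the cofactor in the monomial basis and compare coefficients at κ in the group algebra;
the common product of roots cancels. -/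
theorem dvd_of_incl_dvd (hlam : ∀ i, lam i ≠ 0) {κ : Residues p}
    {f g : MvPolynomial (Fin (d + 1)) k} (h : incl lam p f ∣ monoX lam p p κ * incl lam p g) :
    f ∣ g := by
  obtain ⟨r, hr⟩ := h
  obtain ⟨h, rfl⟩ := exists_eq_sum_monoX_mul_incl hlam r
  refine ⟨h κ, ?_⟩
  have h1 := congrArg (toGroupAlgebra lam p fun i => dvd_refl (p i)) hr
  rw [toGroupAlgebra_monoX_mul_incl, map_mul, map_sum, toGroupAlgebra_incl, Finset.mul_sum] at h1
  simp only [toGroupAlgebra_monoX_mul_incl, AddMonoidAlgebra.single_mul_single, zero_add] at h1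
  have h2 := congrArg (fun x => x.coeff κ) h1
  simp only [AddMonoidAlgebra.coeff_sum, AddMonoidAlgebra.coeff_single,
    Finsupp.finsetSum_apply] at h2
  rw [Finset.sum_eq_single κ (fun κ' _ hne => Finsupp.single_eq_of_ne' hne)
    (fun h => absurd (Finset.mem_univ κ) h), Finsupp.single_eq_same, Finsupp.single_eq_same,
    mul_left_comm, ← map_mul] at h2
  exact toRootField_injective (mul_left_cancel₀ (prod_root_pow_ne_zero hlam _) h2)

/-- Multiplying by `X_i ^ (p_i - 1)` turns the divisor into `X_i ^ p_i = ℓ_i`. Since `κ i = 0`, the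
other side remains a normal form, with i-th residue `p_i - 1`. -/
theorem form_dvd_of_varX_dvd (hlam : ∀ i, lam i ≠ 0) {κ : Residues p} {i : Fin n} (hκ : κ i = 0)
    {g : MvPolynomial (Fin (d + 1)) k} (h : varX lam p i ∣ monoX lam p p κ * incl lam p g) :
    form (lam i) ∣ g := by
  have hp : 1 ≤ p i := Nat.one_le_iff_ne_zero.2 (NeZero.ne _)
  have h1 : monoX lam p p κ * varX lam p i ^ (p i - 1) =
      monoX lam p p (Function.update κ i ((p i - 1 : ℕ) : ZMod (p i))) := by
    rw [monoX, monoX, ← Finset.mul_prod_erase _ _ (Finset.mem_univ i),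
      ← Finset.mul_prod_erase _ _ (Finset.mem_univ i), hκ, Function.update_self, ZMod.val_zero,
      pow_zero, one_mul, mul_comm, ZMod.val_cast_of_lt (by omega)]
    refine congrArg _ (Finset.prod_congr rfl fun j hj => ?_)
    rw [Function.update_of_ne (Finset.ne_of_mem_erase hj)]
  refine dvd_of_incl_dvd hlam (κ := Function.update κ i ((p i - 1 : ℕ) : ZMod (p i))) (f := form (lam i)) ?_
  rw [incl_form, ← h1, ← Nat.sub_add_cancel hp, pow_succ, Nat.add_sub_cancel, mul_right_comm,
    mul_comm _ (varX lam p i ^ _)]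
  exact mul_dvd_mul_left _ h

/-- A factor with non-zero i-th residue is visibly divisible by `X_i`. If both residues vanish,
`ℓ_i` divides the carries times `f * f'`; no carry contains `ℓ_i`, and distinctness excludes the
other forms, so `ℓ_i` divides f or f'. -/
theorem isGPrimeElem_varX (hlam : ∀ i, lam i ≠ 0) (hdist : DistinctHyperplanes lam) (i : Fin n) :
    IsGPrimeElem (gradingR lam p) (varX lam p i) := by
  refine isGPrimeElem_of_dvd ⟨_, varX_mem_gradingR i⟩ ?_ ?_ ?_
  · intro h
    have h1 := congrArg (toGroupAlgebra lam p fun i => dvd_refl (p i)) h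
    rw [toGroupAlgebra_varX, map_zero, AddMonoidAlgebra.single_eq_zero] at h1
    exact root_ne_zero lam p (hlam i) h1
  · intro h
    have := form_dvd_of_varX_dvd hlam (κ := (0 : Residues p)) (i := i) rfl (g := 1)
      (by rwa [monoX_zero, map_one, one_mul])
    exact (form_prime (hlam i)).not_dvd_one this
  · rintro a b ⟨g, ha⟩ ⟨h, hb⟩ hab
    obtain ⟨m, f, -, rfl⟩ := exists_eq_monoX_mul_incl lam ha
    obtain ⟨m', f', -, rfl⟩ := exists_eq_monoX_mul_incl lam hb
    set κ := fullResidue p g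
    set κ' := fullResidue p h
    have hdvd : ∀ κ : Residues p, κ i ≠ 0 → varX lam p i ∣ monoX lam p p κ := fun κ hκ =>
      (dvd_pow_self _ ((ZMod.val_ne_zero _).2 hκ)).trans
        (Finset.dvd_prod_of_mem (fun i => varX lam p i ^ (κ i).val) (Finset.mem_univ i))
    have hform : ∀ f, form (lam i) ∣ f → varX lam p i ∣ incl lam p f := fun f hf => by
      refine dvd_trans ?_ (map_dvd (incl lam p) hf)
      rw [incl_form]
      exact dvd_pow_self _ (NeZero.ne _)
    by_cases hκ : κ i = 0
    · by_cases hκ' : κ' i = 0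
      · rw [mul_normalForms] at hab
        have h1 := form_dvd_of_varX_dvd hlam (by rw [Pi.add_apply, hκ, hκ', add_zero]) hab
        rcases (form_prime (hlam i)).dvd_or_dvd h1 with h2 | h2
        · obtain ⟨j, -, hj⟩ := (form_prime (hlam i)).exists_mem_finset_dvd h2
          by_cases hij : i = j
          · subst hij
            rw [carry_eq_zero hκ, pow_zero] at hj
            exact absurd hj (form_prime (hlam i)).not_dvd_one
          · exact absurd (hdist i j hij) (not_linearIndependent_of_form_dvd (hlam i) (hlam j)
              ((form_prime (hlam i)).dvd_of_dvd_pow hj))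
        · exact ((form_prime (hlam i)).dvd_or_dvd h2).imp
            (fun h => (hform _ h).mul_left _) (fun h => (hform _ h).mul_left _)
      · exact Or.inr ((hdvd _ hκ').mul_right _)
    · exact Or.inl ((hdvd _ hκ).mul_right _)

/-- The carries are products of the `ℓ_i`, none of which q divides, so primality passes from `k[T]`
to normal forms. -/
theorem isGPrimeElem_incl (hlam : ∀ i, lam i ≠ 0) {q : MvPolynomial (Fin (d + 1)) k} {m : ℕ}
    (hq : Prime q) (hm : q.IsHomogeneous m) (hform : ∀ i, ¬ q ∣ form (lam i)) :
    IsGPrimeElem (gradingR lam p) (incl lam p q) := by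
  refine isGPrimeElem_of_dvd ⟨_, incl_mem_gradingR hm⟩ ?_ ?_ ?_
  · intro h
    have h1 := congrArg (toGroupAlgebra lam p fun i => dvd_refl (p i)) h
    rw [toGroupAlgebra_incl, map_zero, AddMonoidAlgebra.single_eq_zero,
      map_eq_zero_iff _ toRootField_injective] at h1
    exact hq.ne_zero h1
  · intro h
    exact hq.not_dvd_one (dvd_of_incl_dvd hlam (κ := (0 : Residues p))
      (by rwa [monoX_zero, map_one, one_mul]))
  · rintro a b ⟨g, ha⟩ ⟨h, hb⟩ hab
    obtain ⟨m, f, -, rfl⟩ := exists_eq_monoX_mul_incl lam ha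
    obtain ⟨m', f', -, rfl⟩ := exists_eq_monoX_mul_incl lam hb
    rw [mul_normalForms] at hab
    rcases hq.dvd_or_dvd (dvd_of_incl_dvd hlam hab) with h2 | h2
    · obtain ⟨j, -, hj⟩ := hq.exists_mem_finset_dvd h2
      exact absurd (hq.dvd_of_dvd_pow hj) (hform j)
    · exact (hq.dvd_or_dvd h2).imp (fun h => (map_dvd (incl lam p) h).mul_left _)
        (fun h => (map_dvd (incl lam p) h).mul_left _)

variable (lam p) in
/-- The products of `G`-prime elements, up to scalars. -/
def IsScaledPrimeProduct (a : GLRing lam p) : Prop :=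
  ∃ (c : k) (s : Multiset (GLRing lam p)), c ≠ 0 ∧ (∀ b ∈ s, IsGPrimeElem (gradingR lam p) b) ∧
    a = c • s.prod

omit [∀ i, NeZero (p i)] in
theorem IsScaledPrimeProduct.mul {a b : GLRing lam p} (ha : IsScaledPrimeProduct lam p a)
    (hb : IsScaledPrimeProduct lam p b) : IsScaledPrimeProduct lam p (a * b) := by
  obtain ⟨c, s, hc, hs, rfl⟩ := ha
  obtain ⟨c', s', hc', hs', rfl⟩ := hb
  refine ⟨c * c', s + s', mul_ne_zero hc hc', fun b hb => ?_, ?_⟩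
  · exact (Multiset.mem_add.1 hb).elim (hs b) (hs' b)
  · rw [Multiset.prod_add, smul_mul_smul_comm]

omit [∀ i, NeZero (p i)] in
theorem isScaledPrimeProduct_C {c : k} (hc : c ≠ 0) :
    IsScaledPrimeProduct lam p (incl lam p (C c)) :=
  ⟨c, 0, hc, by simp, by rw [algHom_C, Multiset.prod_zero, Algebra.algebraMap_eq_smul_one]⟩

omit [∀ i, NeZero (p i)] in
theorem isScaledPrimeProduct_one : IsScaledPrimeProduct lam p 1 := by
  simpa using isScaledPrimeProduct_C (lam := lam) (p := p) one_ne_zero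

omit [∀ i, NeZero (p i)] in
theorem IsScaledPrimeProduct.of_prime {a : GLRing lam p} (ha : IsGPrimeElem (gradingR lam p) a) :
    IsScaledPrimeProduct lam p a :=
  ⟨1, {a}, one_ne_zero, by simpa using ha, by simp⟩

omit [∀ i, NeZero (p i)] in
theorem IsScaledPrimeProduct.pow {a : GLRing lam p} (ha : IsScaledPrimeProduct lam p a) (m : ℕ) :
    IsScaledPrimeProduct lam p (a ^ m) := by
  induction m with
  | zero => rw [pow_zero]; exact isScaledPrimeProduct_one
  | succ m ih => rw [pow_succ]; exact ih.mul ha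

theorem isScaledPrimeProduct_incl (hlam : ∀ i, lam i ≠ 0) (hdist : DistinctHyperplanes lam)
    (f : MvPolynomial (Fin (d + 1)) k) :
    f ≠ 0 → (∃ m, f.IsHomogeneous m) → IsScaledPrimeProduct lam p (incl lam p f) := by
  induction f using UniqueFactorizationMonoid.induction_on_prime with
  | h₁ => exact fun h => absurd rfl h
  | h₂ f hf =>
    intro _ _
    obtain ⟨c, hc, rfl⟩ := exists_C_of_isUnit hf
    exact isScaledPrimeProduct_C hc
  | h₃ a q ha hq ih =>
    rintro h0 ⟨m, hm⟩
    obtain ⟨mq, hmq⟩ := hm.exists_of_mul h0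
    obtain ⟨ma, hma⟩ := (mul_comm q a ▸ hm).exists_of_mul (mul_comm q a ▸ h0)
    rw [map_mul]
    refine IsScaledPrimeProduct.mul ?_ (ih ha ⟨ma, hma⟩)
    -- A prime factor dividing some `ℓ_i` is a scalar multiple of it, hence of `X_i ^ p_i`; any
    -- other stays prime in R.
    by_cases hform : ∃ i, q ∣ form (lam i)
    · obtain ⟨i, hi⟩ := hform
      obtain ⟨u, hu⟩ := (form_irreducible (hlam i)).associated_of_dvd hq.irreducible
        ((hq.irreducible.dvd_symm (form_irreducible (hlam i)) hi))
      obtain ⟨c, hc, hcu⟩ := exists_C_of_isUnit u.isUnit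
      rw [← hu, map_mul, incl_form, hcu]
      exact ((IsScaledPrimeProduct.of_prime (isGPrimeElem_varX hlam hdist i)).pow _).mul
        (isScaledPrimeProduct_C hc)
    · exact IsScaledPrimeProduct.of_prime (isGPrimeElem_incl hlam hq hmq (not_exists.1 hform))

theorem isGFactorial_gradingR (hlam : ∀ i, lam i ≠ 0) (hdist : DistinctHyperplanes lam) :
    IsGFactorial (gradingR lam p) := by
  refine ⟨isGDomain_gradingR hlam, ?_⟩
  rintro a ⟨g, ha⟩ ha0 hau
  obtain ⟨m, f, hf, rfl⟩ := exists_eq_monoX_mul_incl lam ha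
  have hf0 : f ≠ 0 := by rintro rfl; simp at ha0
  have hmono : IsScaledPrimeProduct lam p (monoX lam p p (fullResidue p g)) :=
    Finset.prod_induction _ (IsScaledPrimeProduct lam p) (fun _ _ => IsScaledPrimeProduct.mul)
      isScaledPrimeProduct_one fun i _ =>
        (IsScaledPrimeProduct.of_prime (isGPrimeElem_varX hlam hdist i)).pow _
  obtain ⟨c, s, hc, hs, heq⟩ := hmono.mul (isScaledPrimeProduct_incl hlam hdist f hf0 ⟨m, hf⟩)
  rw [heq] at hau ⊢
  -- The scalar is absorbed into one prime factor; with no factors the element would be a unit.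
  induction s using Multiset.induction_on with
  | empty =>
    refine absurd ?_ hau
    rw [Multiset.prod_zero, ← Algebra.algebraMap_eq_smul_one]
    exact (isUnit_iff_ne_zero.2 hc).map _
  | cons b s _ =>
    refine ⟨(c • b) ::ₘ s, fun b' hb' => ?_, by
      rw [Multiset.prod_cons, Multiset.prod_cons, smul_mul_assoc]⟩
    rcases Multiset.mem_cons.1 hb' with rfl | hb'
    · obtain ⟨⟨g', t, ht, htb⟩, hb0, hbp⟩ := hs b (Multiset.mem_cons_self b s)
      refine ⟨⟨g', c • t, Submodule.smul_mem _ c ht, congrArg (c • ·) htb⟩, smul_ne_zero hc hb0, ?_⟩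
      have h : Ideal.span {c • b} = Ideal.span {b} := span_singleton_smul hc b
      rwa [h]
    · exact hs b' (Multiset.mem_cons_of_mem hb')

end Factorial

end GeigleLenzing

end

noncomputable section

/-! ### Coarsening a grading along a group homomorphism. -/

section CoarseGrading

variable {G : Type*} [AddCommGroup G] [DecidableEq G] {A : Type u} [CommRing A]
variable {σ : Type*} [SetLike σ A] [AddSubgroupClass σ A] {𝒜 : G → σ} [GradedRing 𝒜]
variable {K : Type*} [AddCommGroup K] (φ : G →+ K)

namespace GrMod

/-- The homogeneous components of a graded module with respect to the coarser grading defined by a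
group homomorphism. -/
def coarseComp (M : GrMod 𝒜) (κ : K) : AddSubgroup M.carrier :=
  AddSubgroup.closure {m | ∃ g, φ g = κ ∧ m ∈ M.comp g}

variable {φ}

theorem smul_mem_coarseComp (M : GrMod 𝒜) {h : G} {a : A} (ha : a ∈ 𝒜 h) {κ : K} {m : M.carrier}
    (hm : m ∈ M.coarseComp φ κ) : a • m ∈ M.coarseComp φ (φ h + κ) := by
  induction hm using AddSubgroup.closure_induction with
  | mem x hx =>
    obtain ⟨g, rfl, hx⟩ := hx
    exact AddSubgroup.subset_closure ⟨h + g, map_add _ _ _, M.smul_mem _ _ _ _ ha hx⟩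
  | zero => rw [smul_zero]; exact zero_mem _
  | add x y _ _ hx hy => rw [smul_add]; exact add_mem hx hy
  | neg x _ hx => rw [smul_neg]; exact neg_mem hx

theorem proj_of_mem_coarseComp (M : GrMod 𝒜) {κ : K} {m : M.carrier}
    (hm : m ∈ M.coarseComp φ κ) {g : G} (hg : φ g ≠ κ) : M.proj g m = 0 := by
  induction hm using AddSubgroup.closure_induction with
  | mem x hx =>
    obtain ⟨h, rfl, hx⟩ := hx
    exact M.proj_of_mem_ne hx fun he => hg (congrArg φ he).symm
  | zero => exact map_zero _
  | add x y _ _ hx hy => rw [map_add, hx, hy, add_zero]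
  | neg x _ hx => rw [map_neg, hx, neg_zero]

theorem eq_zero_of_sum_coarseComp [Fintype K] (M : GrMod 𝒜) (y : K → M.carrier)
    (hy : ∀ κ, y κ ∈ M.coarseComp φ κ) (hsum : ∑ κ, y κ = 0) (κ : K) : y κ = 0 := by
  obtain ⟨s, hs⟩ := M.exists_sum_proj (y κ)
  rw [← hs]
  refine Finset.sum_eq_zero fun g _ => ?_
  by_cases hg : φ g = κ
  · have h := congrArg (M.proj g) hsum
    rwa [map_sum, map_zero, Finset.sum_eq_single κ
      (fun κ' _ hne => M.proj_of_mem_coarseComp (hy κ') fun h => hne (h.symm.trans hg))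
      (fun h => absurd (Finset.mem_univ κ) h)] at h
  · exact M.proj_of_mem_coarseComp (hy κ) hg

variable (φ) in
theorem exists_sum_coarseComp [Fintype K] (M : GrMod 𝒜) (m : M.carrier) :
    ∃ y : K → M.carrier, (∀ κ, y κ ∈ M.coarseComp φ κ) ∧ ∑ κ, y κ = m := by
  classical
  obtain ⟨s, hs⟩ := M.exists_sum_proj m
  refine ⟨fun κ => ∑ g ∈ s with φ g = κ, M.proj g m, fun κ => sum_mem fun g hg => ?_, ?_⟩
  · exact AddSubgroup.subset_closure ⟨g, (Finset.mem_filter.1 hg).2, M.proj_mem g m⟩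
  · exact (Finset.sum_fiberwise s φ _).trans hs

end GrMod

variable {φ}

theorem algebraMap_mem_locGrading {S : Submonoid A} (hS : ∀ s ∈ S, SetLike.IsHomogeneousElem 𝒜 s)
    {g : G} {a : A} (ha : a ∈ 𝒜 g) : algebraMap A (Localization S) a ∈ locGrading 𝒜 S hS g :=
  ⟨0, a, 1, by rwa [add_zero], SetLike.GradedOne.one_mem, (Localization.mk_one_eq_algebraMap a).symm⟩

/-- The local bound on the projective dimension of graded modules over a localization of a graded
ring that has a homogeneous basis over a subring of global dimension `n`. -/
theorem modPdLE_localizedModule_of_homogeneous_basis {B : Type u} [CommRing B] [Algebra B A]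
    [Fintype K] (S : Submonoid A) (hS : ∀ s ∈ S, SetLike.IsHomogeneousElem 𝒜 s)
    (hB : ∀ x : B, algebraMap B A x ∈ Subring.closure {a : A | ∃ g, φ g = 0 ∧ a ∈ 𝒜 g})
    (b : Module.Basis K B A) (hb : ∀ κ, ∃ g, φ g = κ ∧ b κ ∈ 𝒜 g)
    (u : K → B) (hu : ∀ κ, algebraMap B A (u κ) = b κ * b (-κ)) {n : ℕ} (hn : GlobalDimLE B n)
    (M : GrMod (locGrading 𝒜 S hS)) (m : Ideal (Localization S)) [m.IsPrime]
    (hm : ∀ κ, algebraMap A (Localization S) (b κ) ∉ m) :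
    ModPdLE (Localization m.primeCompl) (LocalizedModule m.primeCompl M.carrier) n := by
  let _ : Module B M.carrier := Module.compHom M.carrier (algebraMap B (Localization S))
  have : IsScalarTower B (Localization S) M.carrier :=
    ⟨fun b a x => by rw [Algebra.smul_def, mul_smul]; rfl⟩
  -- Elements of φ-degree zero preserve the coarse components, and so does the subring they
  -- generate; this makes the components B-submodules.
  have hstable : ∀ a ∈ Subring.closure {a : A | ∃ g, φ g = 0 ∧ a ∈ 𝒜 g}, ∀ κ,
      ∀ x ∈ M.coarseComp φ κ, algebraMap A (Localization S) a • x ∈ M.coarseComp φ κ := by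
    intro a ha κ
    induction ha using Subring.closure_induction with
    | mem a ha =>
      obtain ⟨g, hg, ha⟩ := ha
      intro x hx
      have := M.smul_mem_coarseComp (algebraMap_mem_locGrading hS ha) hx
      rwa [hg, zero_add] at this
    | zero => intro x _; rw [map_zero, zero_smul]; exact zero_mem _
    | one => intro x hx; rwa [map_one, one_smul]
    | add a b _ _ ha hb =>
      intro x hx; rw [map_add, add_smul]; exact add_mem (ha x hx) (hb x hx)
    | neg a _ ha => intro x hx; rw [map_neg, neg_smul]; exact neg_mem (ha x hx)
    | mul a b _ _ ha hb => intro x hx; rw [map_mul, mul_smul]; exact ha _ (hb x hx)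
  refine modPdLE_localizedModule_of_decomposition S b u hu
    (fun κ => { M.coarseComp φ κ with
      smul_mem' := fun c x hx => ?_ }) ?_ ?_ ?_ hn m ?_
  · have h := hstable _ (hB c) κ x hx
    rwa [← IsScalarTower.algebraMap_apply] at h
  · exact fun y hy => M.eq_zero_of_sum_coarseComp y hy
  · exact M.exists_sum_coarseComp φ
  · intro κ κ' x hx
    obtain ⟨g, hg, hbg⟩ := hb κ
    have h := M.smul_mem_coarseComp (algebraMap_mem_locGrading hS hbg) hx
    rwa [hg] at h
  · intro κ hκ
    rw [IsScalarTower.algebraMap_apply B A, hu, map_mul] at hκ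
    exact (Ideal.IsPrime.mem_or_mem ‹_› hκ).elim (hm _) (hm _)

theorem isIntegralElem_of_pow {B C : Type*} [CommRing B] [CommRing C] (f : B →+* C) {x : C} {n : ℕ}
    (hn : 0 < n) (h : f.IsIntegralElem (x ^ n)) : f.IsIntegralElem x := by
  let _ := f.toAlgebra
  exact IsIntegral.of_pow hn h

/-- In a domain integral over C, an ideal with zero contraction is zero; here the ideal is the
kernel of β. -/
theorem injective_of_comp_isIntegral {C B D : Type*} [CommRing C] [Nontrivial C] [CommRing B]
    [IsDomain B] [CommRing D] (τ : C →+* B) (hτ : τ.IsIntegral) (β : B →+* D)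
    (h : Function.Injective (β.comp τ)) : Function.Injective β := by
  algebraize [τ]
  rw [RingHom.injective_iff_ker_eq_bot] at h ⊢
  refine Ideal.eq_bot_of_comap_eq_bot (R := C) ?_
  rw [← h, ← RingHom.comap_ker]
  rfl

end CoarseGrading

namespace GeigleLenzing

open MvPolynomial

/-! ### Polynomial subrings of R from independent forms. -/

section Coordinates

variable {k : Type u} [Field k] {d n : ℕ} {lam : Fin n → Fin (d + 1) → k} {p : Fin n → ℕ}

variable (k d) in
/-- The linear form with given coefficients, as a linear map. -/
def formMap : (Fin (d + 1) → k) →ₗ[k] MvPolynomial (Fin (d + 1)) k :=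
  Fintype.linearCombination k X

theorem formMap_apply (v : Fin (d + 1) → k) : formMap k d v = form v := by
  simp only [formMap, Fintype.linearCombination_apply, form, smul_eq_C_mul]

theorem form_single (j : Fin (d + 1)) : form (Pi.single j (1 : k)) = X j := by
  rw [← formMap_apply, formMap, Fintype.linearCombination_apply_single, one_smul]

/-- The exponents truncated to one on a set of indices. -/
def truncate (p : Fin n → ℕ) (I : Finset (Fin n)) (i : Fin n) : ℕ := if i ∈ I then 1 else p i

theorem truncate_dvd (I : Finset (Fin n)) (i : Fin n) : truncate p I i ∣ p i := by
  rw [truncate]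
  split_ifs
  · exact one_dvd _
  · exact dvd_refl _

instance [∀ i, NeZero (p i)] (I : Finset (Fin n)) (i : Fin n) : NeZero (truncate p I i) :=
  ⟨ne_zero_of_dvd_ne_zero (NeZero.ne (p i)) (truncate_dvd I i)⟩

/-- `ZMod 1` is trivial, so `X_i` with `i ∈ I` has residue zero and may belong to the base ring. -/
theorem single_truncate_eq_zero {I : Finset (Fin n)} {i : Fin n} (hi : i ∈ I) :
    (Pi.single i 1 : Residues (truncate p I)) = 0 := by
  have h : truncate p I i = 1 := if_pos hi
  have : Subsingleton (ZMod (truncate p I i)) := by rw [h]; infer_instance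
  rw [Subsingleton.elim (1 : ZMod (truncate p I i)) 0, Pi.single_zero]

theorem isIntegral_of_X {k : Type*} [Field k] {ι : Type*} {C : Type*} [CommRing C] [Algebra k C]
    (τ : C →ₐ[k] MvPolynomial ι k) (h : ∀ s, τ.toRingHom.IsIntegralElem (X s)) :
    τ.toRingHom.IsIntegral := by
  intro f
  induction f using MvPolynomial.induction_on with
  | C a =>
    have := τ.toRingHom.isIntegralElem_map (x := algebraMap k C a)
    rwa [show τ.toRingHom (algebraMap k C a) = MvPolynomial.C a from τ.commutes a] at this
  | add f g hf hg => exact hf.add _ hg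
  | mul_X f s hf => exact hf.mul _ (h s)

variable [∀ i, NeZero (p i)]

/-- If the linear forms indexed by `I` are linearly independent, the `X_i` for `i ∈ I` and suitable
linear forms in the `T_j` are homogeneous coordinates of a polynomial subring of `R`. -/
theorem exists_coordinates (I : Finset (Fin n)) (hI : LinearIndependent k fun i : I => lam i) :
    ∃ y : Fin (d + 1) → GLRing lam p,
      (∀ s, ∃ g, residue (truncate p I) (truncate_dvd I) g = 0 ∧ y s ∈ gradingR lam p g) ∧
      (∀ i ∈ I, ∃ s, y s = varX lam p i) ∧
      (∀ j, varT lam p j ∈ (aeval (R := k) y).range) ∧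
      ∃ β : MvPolynomial (Fin (d + 1)) k →ₐ[k] RootField k d, Function.Injective β ∧
        ∀ f, toGroupAlgebra lam (truncate p I) (truncate_dvd I) (aeval y f) =
          AddMonoidAlgebra.single 0 (β f) := by
  classical
  -- Complete the forms with index in I to a basis of all linear forms, reindexed by `Fin (d + 1)`.
  let b₀ := Module.Basis.extend hI.linearIndepOn_id
  let ι : I → hI.linearIndepOn_id.extend (Set.subset_univ _) := fun i =>
    ⟨lam i, hI.linearIndepOn_id.subset_extend _ ⟨i, rfl⟩⟩
  have hι : Function.Injective ι := fun i j hij => hI.injective (congrArg Subtype.val hij)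
  let e := b₀.indexEquiv (Pi.basisFun k (Fin (d + 1)))
  let b := b₀.reindex e
  have hbI : ∀ i : I, b (e (ι i)) = lam i := fun i => by
    rw [Module.Basis.reindex_apply, Equiv.symm_apply_apply]
    exact Module.Basis.extend_apply_self _ _
  have key : ∀ s, (∃ i : I, s = e (ι i)) ∨ ∀ i : I, s ≠ e (ι i) := fun s => by
    by_cases h : ∃ i : I, s = e (ι i)
    · exact Or.inl h
    · exact Or.inr (not_exists.1 h)
  -- The coordinate y is `X_i` with `m = p i` when the basis vector is `lam i`, and the linear form
  -- itself with `m = 1` otherwise; z is its scalar in the root field.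
  have hdata : ∀ s, ∃ (y : GLRing lam p) (z : RootField k d) (m : ℕ), 0 < m ∧
      (∃ g, residue (truncate p I) (truncate_dvd I) g = 0 ∧ y ∈ gradingR lam p g) ∧
      (∀ i : I, s = e (ι i) → y = varX lam p i) ∧
      toGroupAlgebra lam (truncate p I) (truncate_dvd I) y = AddMonoidAlgebra.single 0 z ∧
      y ^ m = incl lam p (form (b s)) ∧ z ^ m = toRootField k d (form (b s)) := by
    intro s
    rcases key s with ⟨i, rfl⟩ | hs
    · refine ⟨varX lam p i, root lam p i, p i, Nat.pos_of_ne_zero (NeZero.ne _),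
        ⟨_, ?_, varX_mem_gradingR _⟩, ?_, ?_, ?_, ?_⟩
      · rw [residue_x, single_truncate_eq_zero i.2]
      · intro j hj
        rw [hι (e.injective hj)]
      · rw [toGroupAlgebra_varX, single_truncate_eq_zero i.2]
      · rw [hbI, incl_form]
      · rw [hbI, root_pow]
    · refine ⟨incl lam p (form (b s)), toRootField k d (form (b s)), 1, one_pos,
        ⟨_, ?_, incl_mem_gradingR (form_isHomogeneous _)⟩, ?_, ?_, pow_one _, pow_one _⟩
      · rw [one_smul, residue_c]
      · exact fun i hi => absurd hi (hs i)
      · exact toGroupAlgebra_incl _ _ _ _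
  choose y z m hm hdeg hyI hyz hyf hzf using hdata
  let L : (Fin (d + 1) → k) →ₗ[k] MvPolynomial (Fin (d + 1)) k := b.constr k fun s => X s ^ m s
  have hL : ∀ s, L (b s) = X s ^ m s := fun s => b.constr_basis k _ s
  have hLy : ∀ v, aeval (R := k) y (L v) = incl lam p (form v) := by
    have h : (aeval (R := k) y).toLinearMap ∘ₗ L = (incl lam p).toLinearMap ∘ₗ formMap k d :=
      b.ext fun s => by
        simp only [LinearMap.comp_apply, AlgHom.toLinearMap_apply, hL, map_pow, aeval_X, hyf,
          formMap_apply]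
    intro v
    rw [← formMap_apply]
    exact DFunLike.congr_fun h v
  have hLz : ∀ v, aeval (R := k) z (L v) = toRootField k d (form v) := by
    have h : (aeval (R := k) z).toLinearMap ∘ₗ L = (toRootField k d).toLinearMap ∘ₗ formMap k d :=
      b.ext fun s => by
        simp only [LinearMap.comp_apply, AlgHom.toLinearMap_apply, hL, map_pow, aeval_X, hzf,
          formMap_apply]
    intro v
    rw [← formMap_apply]
    exact DFunLike.congr_fun h v
  -- The inclusion of `k[T]` into the ring of new coordinates. It is integral because `X s ^ m s` is
  -- the image of a linear form, so injectivity of `aeval z` can be tested after composing with τ.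
  let τ : MvPolynomial (Fin (d + 1)) k →ₐ[k] MvPolynomial (Fin (d + 1)) k :=
    aeval fun j => L (Pi.single j 1)
  have hτ : ∀ v, τ (form v) = L v := by
    have h : τ.toLinearMap ∘ₗ formMap k d = L := (Pi.basisFun k (Fin (d + 1))).ext fun j => by
      simp only [LinearMap.comp_apply, AlgHom.toLinearMap_apply, formMap_apply,
        Pi.basisFun_apply, form_single, τ, aeval_X]
    intro v
    rw [← formMap_apply]
    exact DFunLike.congr_fun h v
  have hzτ : (aeval (R := k) z).comp τ = toRootField k d := by
    refine MvPolynomial.algHom_ext fun j => ?_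
    rw [AlgHom.comp_apply, aeval_X, hLz, form_single]
  refine ⟨y, hdeg, fun i hi => ⟨_, hyI _ ⟨i, hi⟩ rfl⟩, fun j => ⟨L (Pi.single j 1), ?_⟩,
    aeval z, ?_, ?_⟩
  · exact (hLy _).trans (by rw [form_single, incl_X])
  · refine injective_of_comp_isIntegral τ.toRingHom (isIntegral_of_X τ fun s => ?_)
      (aeval (R := k) z).toRingHom ?_
    · refine isIntegralElem_of_pow τ.toRingHom (hm s) ?_
      rw [← hL, ← hτ]
      exact τ.toRingHom.isIntegralElem_map
    · have h : Function.Injective ((aeval (R := k) z).comp τ) := by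
        rw [hzτ]
        exact toRootField_injective
      exact h
  · intro f
    have h : (toGroupAlgebra lam (truncate p I) (truncate_dvd I)).comp (aeval y) =
        (AddMonoidAlgebra.singleZeroAlgHom (R := k) (A := RootField k d)
          (M := Residues (truncate p I))).comp (aeval z) := by
      refine MvPolynomial.algHom_ext fun s => ?_
      rw [AlgHom.comp_apply, AlgHom.comp_apply, aeval_X, aeval_X, hyz]
      rfl
    exact DFunLike.congr_fun h f

end Coordinates

end GeigleLenzing

end

noncomputable section

namespace GeigleLenzing

open MvPolynomial

/-! ### Regularity away from the common zero of the `T_j`. -/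

section Regular

variable {k : Type u} [Field k] {d n : ℕ} {lam : Fin n → Fin (d + 1) → k} {p : Fin n → ℕ}

theorem algebraMap_mem_gradingR (c : k) : algebraMap k (GLRing lam p) c ∈ gradingR lam p 0 :=
  ⟨C c, isWeightedHomogeneous_C (varDeg d p) c, rfl⟩

/-- In general position, the forms `ℓ_i` with `X_i` in an ideal not containing all the `T_j` are
linearly independent. -/
theorem linearIndependent_of_varT_notMem (hgp : GeneralPosition lam) (hp : ∀ i, 0 < p i)
    (J : Ideal (GLRing lam p)) {j : Fin (d + 1)} (hj : varT lam p j ∉ J) (I : Finset (Fin n))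
    (hI : ∀ i ∈ I, varX lam p i ∈ J) : LinearIndependent k fun i : I => lam i := by
  refine hgp I (not_lt.1 fun hlt => hj ?_)
  -- If I had more than `d + 1` elements, `d + 1` of its forms would span all linear forms. Since
  -- `ℓ_i = X_i ^ p_i` lies in J for `i ∈ I`, every `T_j` would lie in J.
  obtain ⟨s, hsI, hs⟩ := Finset.exists_subset_card_eq hlt.le
  have hspan := (hgp s hs.le).span_eq_top_of_card_eq_finrank' (by simp [hs])
  let W : Submodule k (Fin (d + 1) → k) :=
    (J.restrictScalars k).comap ((incl lam p).toLinearMap ∘ₗ formMap k d)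
  have hW : ∀ v, v ∈ W ↔ incl lam p (form v) ∈ J := fun v => by rw [← formMap_apply]; rfl
  have htop : (⊤ : Submodule k (Fin (d + 1) → k)) ≤ W := by
    rw [← hspan, Submodule.span_le]
    rintro _ ⟨i, rfl⟩
    rw [SetLike.mem_coe, hW, incl_form]
    exact Ideal.pow_mem_of_mem _ (hI _ (hsI i.2)) _ (hp _)
  have h := (hW _).1 (htop (Submodule.mem_top (x := Pi.single j 1)))
  rwa [form_single, incl_X] at h

theorem monoX_mem_gradingR {q : Fin n → ℕ} [∀ i, NeZero (q i)] (hqp : ∀ i, q i ∣ p i)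
    (κ : Residues q) : ∃ g, residue q hqp g = κ ∧ monoX lam p q κ ∈ gradingR lam p g := by
  refine ⟨∑ i, (κ i).val • LGroup.x p i, ?_, ?_⟩
  · simp only [map_sum, map_nsmul, residue_x, sum_val_nsmul_single]
  · exact SetLike.prod_mem_graded _ _ _ fun i _ => SetLike.pow_mem_graded _ (varX_mem_gradingR i)

theorem incl_mem_range {y : Fin (d + 1) → GLRing lam p}
    (hT : ∀ j, varT lam p j ∈ (aeval (R := k) y).range) (f : MvPolynomial (Fin (d + 1)) k) :
    incl lam p f ∈ (aeval (R := k) y).range := by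
  have h : (incl lam p).range ≤ (aeval (R := k) y).range := by
    rw [incl, ← Algebra.adjoin_range_eq_range_aeval, Algebra.adjoin_le_iff]
    rintro _ ⟨j, rfl⟩
    exact hT j
  exact h ⟨f, rfl⟩

variable [∀ i, NeZero (p i)]

/-- In general position, a graded localization of `R` in which some `T_j` is invertible is
`𝕃`-regular. -/
theorem isGRegular_locGrading (hlam : ∀ i, lam i ≠ 0) (hgp : GeneralPosition lam)
    (S : Submonoid (GLRing lam p)) (hS : ∀ s ∈ S, SetLike.IsHomogeneousElem (gradingR lam p) s)
    {j : Fin (d + 1)} (hj : varT lam p j ∈ S) : IsGRegular (locGrading (gradingR lam p) S hS) := by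
  classical
  have : IsNoetherianRing (Localization S) := IsLocalization.isNoetherianRing S (Localization S) inferInstance
  refine isGRegular_of_modPdLE (d + 1) fun M => ?_
  have := M.finite
  refine modPdLE_of_forall_isMaximal fun m hmax => ?_
  -- The base ring depends on m: the `X_i` in m become coordinates, and the others, which are
  -- invertible at m, index the basis.
  let I : Finset (Fin n) :=
    Finset.univ.filter fun i => algebraMap _ (Localization S) (varX lam p i) ∈ m
  have hI : ∀ i, i ∈ I ↔ algebraMap _ (Localization S) (varX lam p i) ∈ m := fun i => by simp [I]
  have hli := linearIndependent_of_varT_notMem hgp (fun i => Nat.pos_of_ne_zero (NeZero.ne (p i)))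
    (m.comap (algebraMap (GLRing lam p) (Localization S))) (j := j)
    (fun h => hmax.ne_top (Ideal.eq_top_of_isUnit_mem _ h (IsLocalization.map_units _ ⟨_, hj⟩)))
    I (fun i hi => (hI i).1 hi)
  obtain ⟨y, hy, hyI, hyT, β, hβ, hβy⟩ := exists_coordinates (lam := lam) (p := p) I hli
  let _ : Algebra (MvPolynomial (Fin (d + 1)) k) (GLRing lam p) :=
    (aeval (R := k) y).toRingHom.toAlgebra
  let _ : Module (MvPolynomial (Fin (d + 1)) k) (GLRing lam p) := Algebra.toModule
  have : IsScalarTower k (MvPolynomial (Fin (d + 1)) k) (GLRing lam p) :=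
    IsScalarTower.of_algebraMap_eq fun c => ((aeval (R := k) y).commutes c).symm
  have hX : ∀ i, varX lam p i ^ truncate p I i ∈ (aeval (R := k) y).range := by
    intro i
    rw [truncate]
    split_ifs with hi
    · obtain ⟨s, hs⟩ := hyI i hi
      rw [pow_one, ← hs]
      exact ⟨X s, aeval_X _ _⟩
    · rw [← incl_form]
      exact incl_mem_range hyT _
  obtain ⟨b, hb⟩ := exists_basis_monoX (truncate_dvd I) hlam
    (B := MvPolynomial (Fin (d + 1)) k) hyT hX β
    (fun f hf => (map_eq_zero_iff β hβ).1 hf) hβy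
  -- The exponents of κ and `-κ` add up to multiples of `truncate p I i`, so the product involves
  -- only powers that lie in the base ring.
  have hu : ∀ κ, ∃ u : MvPolynomial (Fin (d + 1)) k,
      algebraMap (MvPolynomial (Fin (d + 1)) k) (GLRing lam p) u = b κ * b (-κ) := by
    intro κ
    have h : b κ * b (-κ) = ∏ i, varX lam p i ^ ((κ i).val + ((-κ) i).val) := by
      simp only [hb, monoX, ← Finset.prod_mul_distrib, pow_add]
    rw [prod_varX_pow lam p (truncate p I)] at h
    simp only [Nat.cast_add, ZMod.natCast_zmod_val, Pi.neg_apply, add_neg_cancel] at h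
    rw [h, show (fun i => 0 : Residues (truncate p I)) = 0 from rfl, monoX_zero, one_mul]
    have hmem : ∏ i, (varX lam p i ^ truncate p I i) ^
        (((κ i).val + (-κ i).val) / truncate p I i) ∈ (aeval (R := k) y).range :=
      prod_mem fun i _ => pow_mem (hX i) _
    exact hmem
  choose u hu using hu
  refine modPdLE_localizedModule_of_homogeneous_basis (φ := residue (truncate p I) (truncate_dvd I))
    S hS (fun f => ?_) b (fun κ => ?_) u hu (globalDimLE_mvPolynomial_fin k (d + 1)) M m
    fun κ hκ => ?_
  · change aeval (R := k) y f ∈ _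
    induction f using MvPolynomial.induction_on with
    | C c =>
      rw [algHom_C]
      exact Subring.subset_closure ⟨0, map_zero _, algebraMap_mem_gradingR c⟩
    | add f g hf hg => rw [map_add]; exact add_mem hf hg
    | mul_X f s hf =>
      rw [map_mul, aeval_X]
      exact mul_mem hf (Subring.subset_closure (hy s))
  · rw [hb]
    exact monoX_mem_gradingR _ κ
  · rw [hb, monoX, map_prod, Ideal.IsPrime.prod_mem_iff] at hκ
    obtain ⟨i, -, hi⟩ := hκ
    rw [map_pow] at hi
    have hiI := (hI i).2 (Ideal.IsPrime.mem_of_pow_mem hmax.isPrime _ hi)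
    -- For `i ∈ I` the truncated exponent is 1, so `X_i` does not occur in the basis monomial.
    have hval : (κ i).val = 0 := by
      have h1 := ZMod.val_lt (κ i)
      have h2 : truncate p I i = 1 := if_pos hiI
      omega
    rw [hval, pow_zero] at hi
    exact hmax.ne_top ((Ideal.eq_top_iff_one _).2 hi)

omit [∀ i, NeZero (p i)] in
/-- A `G`-prime ideal of `R` containing all `T_j` is `G`-maximal. -/
theorem isGMaximal_of_varT_mem {P : Ideal (GLRing lam p)}
    (hP : IsGPrime (gradingR lam p) P) (hT : ∀ j, varT lam p j ∈ P) :
    IsGMaximal (gradingR lam p) P := by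
  have hX : ∀ i, varX lam p i ∈ P := by
    intro i
    by_contra hi
    have hmem : varX lam p i ∈ hP.homogCompl := ⟨⟨_, varX_mem_gradingR i⟩, hi⟩
    refine (pow_mem hmem (p i)).2 ?_
    rw [← incl_form, form, map_sum]
    refine sum_mem fun j _ => ?_
    rw [map_mul, incl_X]
    exact Ideal.mul_mem_left _ _ (hT j)
  -- Once all variables are in P, every residue class is a scalar, so the quotient is k itself.
  have hscalar : ∀ r : GLRing lam p, ∃ c : k, r - algebraMap k _ c ∈ P := by
    intro r
    obtain ⟨s, rfl⟩ := Ideal.Quotient.mk_surjective r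
    induction s using MvPolynomial.induction_on with
    | C c => exact ⟨c, by rw [show Ideal.Quotient.mk (relIdeal lam p) (C c) = algebraMap k _ c
        from rfl, sub_self]; exact zero_mem _⟩
    | add f g hf hg =>
      obtain ⟨c, hc⟩ := hf
      obtain ⟨c', hc'⟩ := hg
      refine ⟨c + c', ?_⟩
      rw [map_add, map_add, add_sub_add_comm]
      exact add_mem hc hc'
    | mul_X f s _ =>
      refine ⟨0, ?_⟩
      rw [map_zero, sub_zero, map_mul]
      refine Ideal.mul_mem_left _ _ ?_
      rcases s with j | i
      · exact hT j
      · exact hX i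
  refine ⟨hP.1, hP.2.1, fun a _ ha => ?_⟩
  obtain ⟨r, rfl⟩ := Ideal.Quotient.mk_surjective a
  obtain ⟨c, hc⟩ := hscalar r
  rw [← Ideal.Quotient.eq] at hc
  rw [hc] at ha ⊢
  have hc0 : c ≠ 0 := by
    rintro rfl
    exact ha (by rw [map_zero, map_zero])
  exact ((isUnit_iff_ne_zero.2 hc0).map _).map _

theorem hasGIsolatedSingularities_gradingR (hlam : ∀ i, lam i ≠ 0) (hgp : GeneralPosition lam) :
    HasGIsolatedSingularities (gradingR lam p) := by
  intro P hP hmax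
  obtain ⟨j, hj⟩ : ∃ j, varT lam p j ∉ P := by
    by_contra! h
    exact hmax (isGMaximal_of_varT_mem hP h)
  exact isGRegular_locGrading hlam hgp hP.homogCompl (fun _ hs => hs.1)
    (j := j) ⟨varT_isHomogeneous lam p j, hj⟩

end Regular

end GeigleLenzing

end
theorem mainTheorem3 {k : Type u} [Field k] {d n : ℕ} (hd : 1 ≤ d)
    (lam : Fin n → Fin (d + 1) → k) (hlam : ∀ i, lam i ≠ 0)
    (p : Fin n → ℕ) (hp : ∀ i, 0 < p i) :
    IsGDomain (GeigleLenzing.gradingR lam p) ∧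
    (GeigleLenzing.DistinctHyperplanes lam → IsGFactorial (GeigleLenzing.gradingR lam p)) ∧
    (GeigleLenzing.GeneralPosition lam →
      HasGIsolatedSingularities (GeigleLenzing.gradingR lam p) ∧
      ∀ j : Fin (d + 1), IsGRegular
        (awayGrading (GeigleLenzing.gradingR lam p) (GeigleLenzing.varT lam p j)
          (GeigleLenzing.varT_isHomogeneous lam p j))) := by
  have : ∀ i, NeZero (p i) := fun i => ⟨(hp i).ne'⟩
  refine ⟨GeigleLenzing.isGDomain_gradingR hlam, GeigleLenzing.isGFactorial_gradingR hlam,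
    fun hgp => ⟨GeigleLenzing.hasGIsolatedSingularities_gradingR hlam hgp, fun j => ?_⟩⟩
  exact GeigleLenzing.isGRegular_locGrading hlam hgp (Submonoid.powers _) _
    (Submonoid.mem_powers _)
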